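/- Let $F$ be a field, $K$ a set and $\Gamma$ a loop-free quiver without multiple directed edges with vertex set $K$. For $k,k'\in K$ write $k\to k'$ if $(k,k')$ is an edge and $(k',k)$ is not, $k\leftarrow k'$ if $k'\to k$, $k\leftrightarrows k'$ if both $(k,k')$ and $(k',k)$ are edges, and $k\not\!\!-\,k'$ if $k\neq k'$ and neither is an edge. Let $n\ge 1$, let $\alpha=(\alpha_k)_{k\in K}$ be a finitely supported tuple of non-negative integers with sum $n$, and let $K^\alpha\subseteq K^n$ be the set of tuples having, for every $k \in K$, exactly $\alpha_k$ components equal to $k$. The simple transposition $s_a$ acts on $K^n$ by exchanging the components $a$ and $a+1$. The quiver Hecke algebra $\mathcal R_\alpha(\Gamma)$ is the unital associative $F$-algebra with generators $e(\boldsymbol{k})$ ($\boldsymbol{k}\in K^\alpha$), $y_1,\dots,y_n$, $\psi_1,\dots,\psi_{n-1}$ and the following relations (R), for all $X=\boldsymbol{k}$, $X'=\boldsymbol{k}'$ in the index set $\mathcal X=K^\alpha$ and all indices $a,b$ for which the terms make sense: $$\sum_{X\in\mathcal X} e(X)=1,\quad e(X)e(X')=\delta_{X,X'}e(X),\quad y_ae(X)=e(X)y_a,\quad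 \psi_ae(X)=e(s_a\cdot X)\psi_a,\quad y_ay_b=y_by_a,$$ $$\psi_ay_b=y_b\psi_a\ \text{ if } b\neq a,a+1,\qquad \psi_a\psi_b=\psi_b\psi_a\ \text{ if }|a-b|>1,$$ $$\psi_ay_{a+1}e(X)=\begin{cases}(y_a\psi_a+1)e(X)&\text{if }X_a=X_{a+1}\\ y_a\psi_ae(X)&\text{if }X_a\ne X_{a+1},\end{cases}\qquad y_{a+1}\psi_ae(X)=\begin{cases}(\psi_ay_a+1)e(X)&\text{if }X_a=X_{a+1}\\ \psi_ay_ae(X)&\text{if }X_a\ne X_{a+1},\end{cases}$$ $$\psi_a^2e(X)=\begin{cases}0&\text{if }X_a=X_{a+1}\\ e(X)&\text{if }X_a\not\!\!-\,X_{a+1}\\ (y_{a+1}-y_a)e(X)&\text{if }X_a\to X_{a+1}\\ (y_a-y_{a+1})e(X)&\text{if }X_a\leftarrow X_{a+1}\\ (y_{a+1}-y_a)(y_a-y_{a+1})e(X)&\text{if }X_a\leftrightarrows X_{a+1},\end{cases}$$ $$\psi_{a+1}\psi_a\psi_{a+1}e(X)=\begin{cases}(\psi_a\psi_{a+1}\psi_a-1)e(X)&\text{if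 }X_{a+2}=X_a\to X_{a+1}\\ (\psi_a\psi_{a+1}\psi_a+1)e(X)&\text{if }X_{a+2}=X_a\leftarrow X_{a+1}\\ (\psi_a\psi_{a+1}\psi_a+2y_{a+1}-y_a-y_{a+2})e(X)&\text{if }X_{a+2}=X_a\leftrightarrows X_{a+1}\\ \psi_a\psi_{a+1}\psi_ae(X)&\text{otherwise.}\end{cases}$$ Let $p\ge1$ and let $\sigma$ be a bijection $K\to K$ that maps edges of $\Gamma$ to edges and satisfies $\sigma^{m}(k)\ne k=\sigma^p(k)$ for all $k\in K$ and $1\le m\le p-1$. Put $\sigma(\boldsymbol{k})=(\sigma(k_1),\dots,\sigma(k_n))$ and $(\sigma\cdot\alpha)_k=\alpha_{\sigma^{-1}(k)}$. Let $[\alpha]$ be the (finite) orbit of $\alpha$ under $\langle\sigma\rangle$, $K^{[\alpha]}=\bigsqcup_{\beta\in[\alpha]}K^\beta$, and $\mathcal R_{[\alpha]}(\Gamma)=\bigoplus_{\beta\in[\alpha]}\mathcal R_\beta(\Gamma)$, with $y_a$ and $\psi_a$ in $\mathcal R_{[\alpha]}(\Gamma)$ denoting the sums over $\beta$ of the corresponding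 generators. The maps $\mathcal R_\beta(\Gamma)\to\mathcal R_{\sigma\cdot\beta}(\Gamma)$, $e(\boldsymbol{k})\mapsto e(\sigma(\boldsymbol{k}))$, $y_a\mapsto y_a$, $\psi_a\mapsto\psi_a$, define an automorphism $\sigma$ of $\mathcal R_{[\alpha]}(\Gamma)$; let $\mathcal R_{[\alpha]}(\Gamma)^\sigma$ be its fixed-point subalgebra. Let $K^{[\alpha]}_\sigma$ be the quotient of $K^{[\alpha]}$ by the equivalence relation generated by $\boldsymbol{k}\sim\sigma(\boldsymbol{k})$, and $e(\gamma)=\sum_{\boldsymbol{k}\in\gamma}e(\boldsymbol{k})\in\mathcal R_{[\alpha]}(\Gamma)$ for $\gamma\in K^{[\alpha]}_\sigma$. For such $\gamma$, the class $s_a\cdot\gamma$ and the conditions $\gamma_a=\gamma_b$, $\gamma_a\to\gamma_b$, etc., are defined by means of any representative of $\gamma$. Then the algebra $\mathcal R_{[\alpha]}(\Gamma)^\sigma$ is presented by the generators $e(\gamma)$ ($\gamma\in K^{[\alpha]}_\sigma$), $y_1,\dots,y_n$, $\psi_1,\dots,\psi_{n-1}$ and the relations (R) with index set $\mathcal X=K^{[\alpha]}_\sigma$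 (that is, with $\boldsymbol{k}$ replaced by $\gamma$). Precisely: there is an isomorphism of $F$-algebras from the algebra with this presentation onto $\mathcal R_{[\alpha]}(\Gamma)^\sigma$ that sends the generators $e(\gamma)$, $y_a$, $\psi_a$ to the elements $e(\gamma)$, $y_a$, $\psi_a$ of $\mathcal R_{[\alpha]}(\Gamma)$. -/

import Mathlib

/-!
# Quiver Hecke algebras, and the fixed points of a free quiver automorphism

A loop-free quiver without multiple directed edges, with vertex set `K`, is a `Digraph K` with
irreflexive adjacency relation. The positions `1, …, n` of a tuple are the elements of `Fin n`, so
that `y_{a+1}` is `y ⟨a, _⟩`; the generators `ψ_1, …, ψ_{n-1}` are indexed by `Fin (n - 1)`.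
-/

namespace QHA

/-! ### The relations of quiver Hecke type -/

/-- The generators `e(x)` (`x ∈ X`), `y_1, …, y_n` and `ψ_1, …, ψ_{n-1}`. -/
inductive Gen (n : ℕ) (X : Type*) where
  | e (x : X) : Gen n X
  | y (a : Fin n) : Gen n X
  | psi (a : Fin (n - 1)) : Gen n X

/-- What the relations of quiver Hecke type refer to for an index set `X` of the idempotents: the
element `s_a · x`, the truth of `x_a = x_b`, and the truth of "`(x_a, x_b)` is an edge". It is used
below for two explicit index sets only: tuples of vertices, and `σ`-orbits of such tuples. -/
structure IndexData (n : ℕ) (X : Type*) where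
  /-- `x ↦ s_a · x`, where `s_a` exchanges the positions `a` and `a + 1`. -/
  swap : (a : ℕ) → a + 1 < n → X → X
  /-- `same a b x` means `x_a = x_b`. -/
  same : Fin n → Fin n → X → Prop
  /-- `edge a b x` means that `(x_a, x_b)` is an edge of the quiver. -/
  edge : Fin n → Fin n → X → Prop

section Relations

variable (F : Type*) [CommRing F] {n : ℕ} {X : Type*}

/-- The free generator `e(x)`. -/
def fe (n : ℕ) {X : Type*} (x : X) : FreeAlgebra F (Gen n X) :=
  FreeAlgebra.ι F (Gen.e x)

/-- The free generator `y_a`. -/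
def fy {n : ℕ} (X : Type*) (a : Fin n) : FreeAlgebra F (Gen n X) :=
  FreeAlgebra.ι F (Gen.y a)

/-- The free generator `ψ_a`. -/
def fpsi {n : ℕ} (X : Type*) (a : Fin (n - 1)) : FreeAlgebra F (Gen n X) :=
  FreeAlgebra.ι F (Gen.psi a)

/-- The relations of quiver Hecke type. In the relations below, `x_a → x_b` is
`D.edge a b x ∧ ¬ D.edge b a x`, and `x_a ⇆ x_b` is `D.edge a b x ∧ D.edge b a x`. -/
inductive Rel (D : IndexData n X) [Fintype X] :
    FreeAlgebra F (Gen n X) → FreeAlgebra F (Gen n X) → Prop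
  | sum_e : Rel D (∑ x : X, fe F n x) 1
  | e_mul_self (x : X) : Rel D (fe F n x * fe F n x) (fe F n x)
  | e_mul_ne (x x' : X) (h : x ≠ x') : Rel D (fe F n x * fe F n x') 0
  | y_e (a : Fin n) (x : X) : Rel D (fy F X a * fe F n x) (fe F n x * fy F X a)
  | psi_e (a : ℕ) (ha : a + 1 < n) (x : X) :
      Rel D (fpsi F X ⟨a, by omega⟩ * fe F n x)
        (fe F n (D.swap a ha x) * fpsi F X ⟨a, by omega⟩)
  | y_y (a b : Fin n) : Rel D (fy F X a * fy F X b) (fy F X b * fy F X a)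
  | psi_y (a : Fin (n - 1)) (b : Fin n) (h : b.val ≠ a.val) (h' : b.val ≠ a.val + 1) :
      Rel D (fpsi F X a * fy F X b) (fy F X b * fpsi F X a)
  | psi_psi (a b : Fin (n - 1)) (h : a.val + 1 < b.val ∨ b.val + 1 < a.val) :
      Rel D (fpsi F X a * fpsi F X b) (fpsi F X b * fpsi F X a)
  | psi_y_succ_same (a : ℕ) (ha : a + 1 < n) (x : X)
      (h : D.same ⟨a, by omega⟩ ⟨a + 1, ha⟩ x) :
      Rel D (fpsi F X ⟨a, by omega⟩ * fy F X ⟨a + 1, ha⟩ * fe F n x)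
        ((fy F X ⟨a, by omega⟩ * fpsi F X ⟨a, by omega⟩ + 1) * fe F n x)
  | psi_y_succ_ne (a : ℕ) (ha : a + 1 < n) (x : X)
      (h : ¬ D.same ⟨a, by omega⟩ ⟨a + 1, ha⟩ x) :
      Rel D (fpsi F X ⟨a, by omega⟩ * fy F X ⟨a + 1, ha⟩ * fe F n x)
        (fy F X ⟨a, by omega⟩ * fpsi F X ⟨a, by omega⟩ * fe F n x)
  | y_succ_psi_same (a : ℕ) (ha : a + 1 < n) (x : X)
      (h : D.same ⟨a, by omega⟩ ⟨a + 1, ha⟩ x) :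
      Rel D (fy F X ⟨a + 1, ha⟩ * fpsi F X ⟨a, by omega⟩ * fe F n x)
        ((fpsi F X ⟨a, by omega⟩ * fy F X ⟨a, by omega⟩ + 1) * fe F n x)
  | y_succ_psi_ne (a : ℕ) (ha : a + 1 < n) (x : X)
      (h : ¬ D.same ⟨a, by omega⟩ ⟨a + 1, ha⟩ x) :
      Rel D (fy F X ⟨a + 1, ha⟩ * fpsi F X ⟨a, by omega⟩ * fe F n x)
        (fpsi F X ⟨a, by omega⟩ * fy F X ⟨a, by omega⟩ * fe F n x)
  | psi_sq_same (a : ℕ) (ha : a + 1 < n) (x : X)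
      (h : D.same ⟨a, by omega⟩ ⟨a + 1, ha⟩ x) :
      Rel D (fpsi F X ⟨a, by omega⟩ ^ 2 * fe F n x) 0
  | psi_sq_none (a : ℕ) (ha : a + 1 < n) (x : X)
      (h : ¬ D.same ⟨a, by omega⟩ ⟨a + 1, ha⟩ x)
      (h₁ : ¬ D.edge ⟨a, by omega⟩ ⟨a + 1, ha⟩ x)
      (h₂ : ¬ D.edge ⟨a + 1, ha⟩ ⟨a, by omega⟩ x) :
      Rel D (fpsi F X ⟨a, by omega⟩ ^ 2 * fe F n x) (fe F n x)
  | psi_sq_right (a : ℕ) (ha : a + 1 < n) (x : X)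
      (h₁ : D.edge ⟨a, by omega⟩ ⟨a + 1, ha⟩ x)
      (h₂ : ¬ D.edge ⟨a + 1, ha⟩ ⟨a, by omega⟩ x) :
      Rel D (fpsi F X ⟨a, by omega⟩ ^ 2 * fe F n x)
        ((fy F X ⟨a + 1, ha⟩ - fy F X ⟨a, by omega⟩) * fe F n x)
  | psi_sq_left (a : ℕ) (ha : a + 1 < n) (x : X)
      (h₁ : ¬ D.edge ⟨a, by omega⟩ ⟨a + 1, ha⟩ x)
      (h₂ : D.edge ⟨a + 1, ha⟩ ⟨a, by omega⟩ x) :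
      Rel D (fpsi F X ⟨a, by omega⟩ ^ 2 * fe F n x)
        ((fy F X ⟨a, by omega⟩ - fy F X ⟨a + 1, ha⟩) * fe F n x)
  | psi_sq_both (a : ℕ) (ha : a + 1 < n) (x : X)
      (h₁ : D.edge ⟨a, by omega⟩ ⟨a + 1, ha⟩ x)
      (h₂ : D.edge ⟨a + 1, ha⟩ ⟨a, by omega⟩ x) :
      Rel D (fpsi F X ⟨a, by omega⟩ ^ 2 * fe F n x)
        ((fy F X ⟨a + 1, ha⟩ - fy F X ⟨a, by omega⟩) *
          (fy F X ⟨a, by omega⟩ - fy F X ⟨a + 1, ha⟩) * fe F n x)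
  | braid_right (a : ℕ) (ha : a + 2 < n) (x : X)
      (h : D.same ⟨a + 2, ha⟩ ⟨a, by omega⟩ x)
      (h₁ : D.edge ⟨a, by omega⟩ ⟨a + 1, by omega⟩ x)
      (h₂ : ¬ D.edge ⟨a + 1, by omega⟩ ⟨a, by omega⟩ x) :
      Rel D (fpsi F X ⟨a + 1, by omega⟩ * fpsi F X ⟨a, by omega⟩ *
          fpsi F X ⟨a + 1, by omega⟩ * fe F n x)
        ((fpsi F X ⟨a, by omega⟩ * fpsi F X ⟨a + 1, by omega⟩ *
          fpsi F X ⟨a, by omega⟩ - 1) * fe F n x)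
  | braid_left (a : ℕ) (ha : a + 2 < n) (x : X)
      (h : D.same ⟨a + 2, ha⟩ ⟨a, by omega⟩ x)
      (h₁ : ¬ D.edge ⟨a, by omega⟩ ⟨a + 1, by omega⟩ x)
      (h₂ : D.edge ⟨a + 1, by omega⟩ ⟨a, by omega⟩ x) :
      Rel D (fpsi F X ⟨a + 1, by omega⟩ * fpsi F X ⟨a, by omega⟩ *
          fpsi F X ⟨a + 1, by omega⟩ * fe F n x)
        ((fpsi F X ⟨a, by omega⟩ * fpsi F X ⟨a + 1, by omega⟩ *
          fpsi F X ⟨a, by omega⟩ + 1) * fe F n x)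
  | braid_both (a : ℕ) (ha : a + 2 < n) (x : X)
      (h : D.same ⟨a + 2, ha⟩ ⟨a, by omega⟩ x)
      (h₁ : D.edge ⟨a, by omega⟩ ⟨a + 1, by omega⟩ x)
      (h₂ : D.edge ⟨a + 1, by omega⟩ ⟨a, by omega⟩ x) :
      Rel D (fpsi F X ⟨a + 1, by omega⟩ * fpsi F X ⟨a, by omega⟩ *
          fpsi F X ⟨a + 1, by omega⟩ * fe F n x)
        ((fpsi F X ⟨a, by omega⟩ * fpsi F X ⟨a + 1, by omega⟩ * fpsi F X ⟨a, by omega⟩ +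
          2 * fy F X ⟨a + 1, by omega⟩ - fy F X ⟨a, by omega⟩ - fy F X ⟨a + 2, ha⟩) * fe F n x)
  | braid_otherwise (a : ℕ) (ha : a + 2 < n) (x : X)
      (h : ¬ (D.same ⟨a + 2, ha⟩ ⟨a, by omega⟩ x ∧
        (D.edge ⟨a, by omega⟩ ⟨a + 1, by omega⟩ x ∨
          D.edge ⟨a + 1, by omega⟩ ⟨a, by omega⟩ x))) :
      Rel D (fpsi F X ⟨a + 1, by omega⟩ * fpsi F X ⟨a, by omega⟩ *
          fpsi F X ⟨a + 1, by omega⟩ * fe F n x)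
        (fpsi F X ⟨a, by omega⟩ * fpsi F X ⟨a + 1, by omega⟩ *
          fpsi F X ⟨a, by omega⟩ * fe F n x)

/-- The unital associative `F`-algebra presented by the generators `Gen n X` and the
relations `Rel F D`. -/
abbrev Alg (D : IndexData n X) [Fintype X] : Type _ := RingQuot (Rel F D)

/-- The homomorphism of free algebras induced by a map of index sets: `e(x) ↦ e(φ x)`,
`y_a ↦ y_a`, `ψ_a ↦ ψ_a`. -/
def freeMap (n : ℕ) {X Y : Type*} (φ : X → Y) :
    FreeAlgebra F (Gen n X) →ₐ[F] FreeAlgebra F (Gen n Y) :=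
  FreeAlgebra.lift F fun g => match g with
    | Gen.e x => fe F n (φ x)
    | Gen.y a => fy F Y a
    | Gen.psi a => fpsi F Y a

@[simp] theorem freeMap_fe {Y : Type*} (φ : X → Y) (x : X) :
    freeMap F n φ (fe F n x) = fe F n (φ x) := by simp [freeMap, fe]

@[simp] theorem freeMap_fy {Y : Type*} (φ : X → Y) (a : Fin n) :
    freeMap F n φ (fy F X a) = fy F Y a := by simp [freeMap, fy]

@[simp] theorem freeMap_fpsi {Y : Type*} (φ : X → Y) (a : Fin (n - 1)) :
    freeMap F n φ (fpsi F X a) = fpsi F Y a := by simp [freeMap, fpsi]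

variable (D : IndexData n X) [Fintype X]

/-- The generator `e(x)` of the presented algebra. -/
def e (x : X) : Alg F D := RingQuot.mkAlgHom F (Rel F D) (fe F n x)

/-- The generator `y_a` of the presented algebra. -/
def y (a : Fin n) : Alg F D := RingQuot.mkAlgHom F (Rel F D) (fy F X a)

/-- The generator `ψ_a` of the presented algebra. -/
def psi (a : Fin (n - 1)) : Alg F D := RingQuot.mkAlgHom F (Rel F D) (fpsi F X a)

variable {Y : Type*} (D' : IndexData n Y) [Fintype Y]

variable {D D'} in
/-- The relations are preserved by a bijection of index sets compatible with the index data. -/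
theorem Rel.map (φ : X ≃ Y)
    (hswap : ∀ a ha x, φ (D.swap a ha x) = D'.swap a ha (φ x))
    (hsame : ∀ a b x, D.same a b x ↔ D'.same a b (φ x))
    (hedge : ∀ a b x, D.edge a b x ↔ D'.edge a b (φ x))
    {u v : FreeAlgebra F (Gen n X)} (h : Rel F D u v) :
    Rel F D' (freeMap F n φ u) (freeMap F n φ v) := by
  cases h with
  | sum_e =>
    have : ∑ x : X, fe F n (φ x) = ∑ z : Y, fe F n z := Equiv.sum_comp φ (fun z => fe F n z)
    simpa [map_sum, this] using Rel.sum_e (F := F) (D := D')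
  | e_mul_self x => simpa using Rel.e_mul_self (F := F) (D := D') (φ x)
  | e_mul_ne x x' h =>
    simpa using Rel.e_mul_ne (F := F) (D := D') (φ x) (φ x') (fun h' => h (φ.injective h'))
  | y_e a x => simpa using Rel.y_e (F := F) (D := D') a (φ x)
  | psi_e a ha x => simpa [hswap] using Rel.psi_e (F := F) (D := D') a ha (φ x)
  | y_y a b => simpa using Rel.y_y (F := F) (D := D') a b
  | psi_y a b h h' => simpa using Rel.psi_y (F := F) (D := D') a b h h'
  | psi_psi a b h => simpa using Rel.psi_psi (F := F) (D := D') a b h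
  | psi_y_succ_same a ha x h =>
    simpa using Rel.psi_y_succ_same (F := F) (D := D') a ha (φ x) ((hsame _ _ _).1 h)
  | psi_y_succ_ne a ha x h =>
    simpa using Rel.psi_y_succ_ne (F := F) (D := D') a ha (φ x) (fun k => h ((hsame _ _ _).2 k))
  | y_succ_psi_same a ha x h =>
    simpa using Rel.y_succ_psi_same (F := F) (D := D') a ha (φ x) ((hsame _ _ _).1 h)
  | y_succ_psi_ne a ha x h =>
    simpa using Rel.y_succ_psi_ne (F := F) (D := D') a ha (φ x) (fun k => h ((hsame _ _ _).2 k))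
  | psi_sq_same a ha x h =>
    simpa using Rel.psi_sq_same (F := F) (D := D') a ha (φ x) ((hsame _ _ _).1 h)
  | psi_sq_none a ha x h h₁ h₂ =>
    simpa using Rel.psi_sq_none (F := F) (D := D') a ha (φ x) (fun k => h ((hsame _ _ _).2 k))
      (fun k => h₁ ((hedge _ _ _).2 k)) (fun k => h₂ ((hedge _ _ _).2 k))
  | psi_sq_right a ha x h₁ h₂ =>
    simpa using Rel.psi_sq_right (F := F) (D := D') a ha (φ x)
      ((hedge _ _ _).1 h₁) (fun k => h₂ ((hedge _ _ _).2 k))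
  | psi_sq_left a ha x h₁ h₂ =>
    simpa using Rel.psi_sq_left (F := F) (D := D') a ha (φ x)
      (fun k => h₁ ((hedge _ _ _).2 k)) ((hedge _ _ _).1 h₂)
  | psi_sq_both a ha x h₁ h₂ =>
    simpa using Rel.psi_sq_both (F := F) (D := D') a ha (φ x)
      ((hedge _ _ _).1 h₁) ((hedge _ _ _).1 h₂)
  | braid_right a ha x h h₁ h₂ =>
    simpa using Rel.braid_right (F := F) (D := D') a ha (φ x) ((hsame _ _ _).1 h)
      ((hedge _ _ _).1 h₁) (fun k => h₂ ((hedge _ _ _).2 k))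
  | braid_left a ha x h h₁ h₂ =>
    simpa using Rel.braid_left (F := F) (D := D') a ha (φ x) ((hsame _ _ _).1 h)
      (fun k => h₁ ((hedge _ _ _).2 k)) ((hedge _ _ _).1 h₂)
  | braid_both a ha x h h₁ h₂ =>
    simpa [map_ofNat] using Rel.braid_both (F := F) (D := D') a ha (φ x) ((hsame _ _ _).1 h)
      ((hedge _ _ _).1 h₁) ((hedge _ _ _).1 h₂)
  | braid_otherwise a ha x h =>
    simp only [hsame, hedge] at h
    simpa using Rel.braid_otherwise (F := F) (D := D') a ha (φ x) h

variable {D D'} in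
/-- The algebra homomorphism `e(x) ↦ e(φ x)`, `y_a ↦ y_a`, `ψ_a ↦ ψ_a` induced by a bijection of
index sets compatible with the index data. -/
def Alg.map (φ : X ≃ Y)
    (hswap : ∀ a ha x, φ (D.swap a ha x) = D'.swap a ha (φ x))
    (hsame : ∀ a b x, D.same a b x ↔ D'.same a b (φ x))
    (hedge : ∀ a b x, D.edge a b x ↔ D'.edge a b (φ x)) :
    Alg F D →ₐ[F] Alg F D' :=
  RingQuot.liftAlgHom F ⟨(RingQuot.mkAlgHom F (Rel F D')).comp (freeMap F n φ), fun _ _ h =>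
    RingQuot.mkAlgHom_rel F (Rel.map F φ hswap hsame hedge h)⟩

section MapApply

variable {D D'}
variable (φ : X ≃ Y) (hswap : ∀ a ha x, φ (D.swap a ha x) = D'.swap a ha (φ x))
    (hsame : ∀ a b x, D.same a b x ↔ D'.same a b (φ x))
    (hedge : ∀ a b x, D.edge a b x ↔ D'.edge a b (φ x))

theorem Alg.map_e (x : X) : Alg.map F φ hswap hsame hedge (e F D x) = e F D' (φ x) :=
  (RingQuot.liftAlgHom_mkAlgHom_apply F _ _ _).trans (by simp [e])

theorem Alg.map_y (a : Fin n) : Alg.map F φ hswap hsame hedge (y F D a) = y F D' a :=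
  (RingQuot.liftAlgHom_mkAlgHom_apply F _ _ _).trans (by simp [y])

theorem Alg.map_psi (a : Fin (n - 1)) :
    Alg.map F φ hswap hsame hedge (psi F D a) = psi F D' a :=
  (RingQuot.liftAlgHom_mkAlgHom_apply F _ _ _).trans (by simp [psi])

end MapApply

end Relations

/-! ### Quiver Hecke algebras -/

section QuiverHecke

variable {K : Type*}

/-- The set `K^α` of the `n`-tuples that have, for every `x ∈ K`, exactly `α x` components equal
to `x`. -/
def tuples (n : ℕ) (α : K →₀ ℕ) : Set (Fin n → K) :=
  {k | ∀ x, Nat.card {a // k a = x} = α x}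

theorem finite_tuples (n : ℕ) (α : K →₀ ℕ) : (tuples n α).Finite := by
  refine (Set.Finite.pi' (fun _ : Fin n => α.support.finite_toSet)).subset ?_
  intro k hk a
  have : 0 < Nat.card {b // k b = k a} := Nat.card_pos_iff.2 ⟨⟨a, rfl⟩, inferInstance⟩
  rw [hk] at this
  simpa using this.ne'

noncomputable instance (n : ℕ) (α : K →₀ ℕ) : Fintype (tuples n α) :=
  (finite_tuples n α).fintype

/-- The place permutation `s_a`: exchange of the components `a` and `a + 1`. -/
def swapTuple {n : ℕ} (a : ℕ) (ha : a + 1 < n) (k : Fin n → K) : Fin n → K :=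
  k ∘ Equiv.swap ⟨a, by omega⟩ ⟨a + 1, ha⟩

theorem swapTuple_mem {n : ℕ} {α : K →₀ ℕ} (a : ℕ) (ha : a + 1 < n) {k : Fin n → K}
    (hk : k ∈ tuples n α) : swapTuple a ha k ∈ tuples n α := fun x => by
  rw [← hk x]
  exact Nat.card_congr
    ((Equiv.swap (⟨a, by omega⟩ : Fin n) ⟨a + 1, ha⟩).subtypeEquiv fun b => Iff.rfl)

/-- The index data of `K^α`. -/
def tupleData (Γ : Digraph K) (n : ℕ) (α : K →₀ ℕ) : IndexData n (tuples n α) where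
  swap a ha k := ⟨swapTuple a ha k.1, swapTuple_mem a ha k.2⟩
  same a b k := k.1 a = k.1 b
  edge a b k := Γ.Adj (k.1 a) (k.1 b)

/-- The quiver Hecke algebra `R_α(Γ)`. -/
abbrev R (F : Type*) [CommRing F] (Γ : Digraph K) (n : ℕ) (α : K →₀ ℕ) : Type _ :=
  Alg F (tupleData Γ n α)

end QuiverHecke

/-! ### Free automorphisms and their fixed points -/

/-- An automorphism `σ` of the quiver `Γ` such that `σ ^ m` has no fixed vertex for `0 < m < p`
and `σ ^ p` is the identity, where `p` is a positive integer. -/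
structure FreeAut {K : Type*} (Γ : Digraph K) (p : ℕ) where
  perm : Equiv.Perm K
  map_adj : ∀ k k', Γ.Adj k k' → Γ.Adj (perm k) (perm k')
  pos : 0 < p
  pow_ne : ∀ m, 0 < m → m < p → ∀ k, (perm ^ m) k ≠ k
  pow_eq : ∀ k, (perm ^ p) k = k

section FixedPoints

variable {K : Type*} {Γ : Digraph K} {p : ℕ} (σ : FreeAut Γ p)

theorem FreeAut.adj_iff (k k' : K) : Γ.Adj k k' ↔ Γ.Adj (σ.perm k) (σ.perm k') := by
  refine ⟨σ.map_adj k k', fun h => ?_⟩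
  have key : ∀ m : ℕ, ∀ x x', Γ.Adj x x' → Γ.Adj ((σ.perm ^ m) x) ((σ.perm ^ m) x') := by
    intro m
    induction m with
    | zero => intro x x' h; simpa using h
    | succ m ih =>
      intro x x' h
      rw [pow_succ, Equiv.Perm.mul_apply, Equiv.Perm.mul_apply]
      exact ih _ _ (σ.map_adj _ _ h)
  have h' := key (p - 1) _ _ h
  have e : ∀ x, (σ.perm ^ (p - 1)) (σ.perm x) = x := fun x => by
    rw [← Equiv.Perm.mul_apply, ← pow_succ, Nat.sub_add_cancel σ.pos, σ.pow_eq]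
  rwa [e, e] at h'

/-- The composition `τ · α`, with `(τ · α)_k = α_{τ⁻¹(k)}`. -/
def permComp (τ : Equiv.Perm K) (α : K →₀ ℕ) : K →₀ ℕ := Finsupp.equivMapDomain τ α

theorem permComp_apply (τ : Equiv.Perm K) (α : K →₀ ℕ) (k : K) :
    permComp τ α k = α (τ⁻¹ k) := rfl

/-- The orbit `[α]` of `α` under the group generated by `σ`. -/
def orbit (α : K →₀ ℕ) : Set (K →₀ ℕ) := Set.range fun m : ℤ => permComp (σ.perm ^ m) α

theorem finite_orbit (α : K →₀ ℕ) : (orbit σ α).Finite := by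
  have hfin : IsOfFinOrder σ.perm :=
    isOfFinOrder_iff_pow_eq_one.2 ⟨p, σ.pos, Equiv.ext σ.pow_eq⟩
  have : ((Subgroup.zpowers σ.perm : Set (Equiv.Perm K))).Finite := hfin.finite_zpowers
  refine (this.image fun τ => permComp τ α).subset ?_
  rintro _ ⟨m, rfl⟩
  exact ⟨σ.perm ^ m, ⟨m, rfl⟩, rfl⟩

theorem permComp_inv_mem {α β : K →₀ ℕ} (hβ : β ∈ orbit σ α) :
    permComp σ.perm⁻¹ β ∈ orbit σ α := by
  obtain ⟨m, rfl⟩ := hβ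
  refine ⟨-1 + m, ?_⟩
  ext k
  simp [permComp_apply, zpow_add]

theorem permComp_mem {α β : K →₀ ℕ} (hβ : β ∈ orbit σ α) :
    permComp σ.perm β ∈ orbit σ α := by
  obtain ⟨m, rfl⟩ := hβ
  refine ⟨1 + m, ?_⟩
  ext k
  simp [permComp_apply, zpow_add]

theorem comp_mem_iff {n : ℕ} (τ : Equiv.Perm K) (β : K →₀ ℕ) (k : Fin n → K) :
    k ∈ tuples n (permComp τ⁻¹ β) ↔ τ ∘ k ∈ tuples n β := by
  have h : ∀ x, Nat.card {a // (τ ∘ k) a = τ x} = Nat.card {a // k a = x} := fun x =>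
    Nat.card_congr ((Equiv.refl _).subtypeEquiv fun a => by simp)
  constructor
  · intro hk x
    obtain ⟨x, rfl⟩ := τ.surjective x
    rw [h, hk, permComp_apply, inv_inv]
  · intro hk x
    rw [← h, hk, permComp_apply, inv_inv]

/-- The bijection `k ↦ σ(k) = (σ(k_1), …, σ(k_n))` from `K^{σ⁻¹ · β}` to `K^β`. -/
def tuplesEquiv (n : ℕ) (β : K →₀ ℕ) : tuples n (permComp σ.perm⁻¹ β) ≃ tuples n β :=
  (Equiv.arrowCongr (Equiv.refl (Fin n)) σ.perm).subtypeEquiv fun k => comp_mem_iff σ.perm β k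

theorem tuplesEquiv_swap (n : ℕ) (β : K →₀ ℕ) (a : ℕ) (ha : a + 1 < n)
    (k : tuples n (permComp σ.perm⁻¹ β)) :
    tuplesEquiv σ n β ((tupleData Γ n _).swap a ha k) =
      (tupleData Γ n β).swap a ha (tuplesEquiv σ n β k) := rfl

theorem tuplesEquiv_same (n : ℕ) (β : K →₀ ℕ) (a b : Fin n)
    (k : tuples n (permComp σ.perm⁻¹ β)) :
    (tupleData Γ n _).same a b k ↔ (tupleData Γ n β).same a b (tuplesEquiv σ n β k) :=
  (σ.perm.apply_eq_iff_eq (x := k.1 a) (y := k.1 b)).symm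

theorem tuplesEquiv_edge (n : ℕ) (β : K →₀ ℕ) (a b : Fin n)
    (k : tuples n (permComp σ.perm⁻¹ β)) :
    (tupleData Γ n _).edge a b k ↔ (tupleData Γ n β).edge a b (tuplesEquiv σ n β k) :=
  σ.adj_iff (k.1 a) (k.1 b)

variable (F : Type*) [CommRing F]

/-- The homomorphism `σ : R_{σ⁻¹ · β}(Γ) → R_β(Γ)` given by `e(k) ↦ e(σ(k))`, `y_a ↦ y_a`,
`ψ_a ↦ ψ_a`. -/
noncomputable def sigmaHom (n : ℕ) (β : K →₀ ℕ) :
    R F Γ n (permComp σ.perm⁻¹ β) →ₐ[F] R F Γ n β :=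
  Alg.map F (tuplesEquiv σ n β) (tuplesEquiv_swap σ n β) (tuplesEquiv_same σ n β)
    (tuplesEquiv_edge σ n β)

/-- The algebra `R_{[α]}(Γ)`, the direct sum of the algebras `R_β(Γ)` over the finite orbit `[α]`,
with componentwise operations. -/
abbrev ROrbit (n : ℕ) (α : K →₀ ℕ) : Type _ := (β : orbit σ α) → R F Γ n β.1

/-- The automorphism `σ` of `R_{[α]}(Γ)`: its component with values in `R_β(Γ)` is
`σ : R_{σ⁻¹ · β}(Γ) → R_β(Γ)`. -/
noncomputable def sigma (n : ℕ) (α : K →₀ ℕ) : ROrbit σ F n α →ₐ[F] ROrbit σ F n α :=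
  AlgHom.pi fun β => (sigmaHom σ F n β.1).comp
    (Pi.evalAlgHom F (fun β : orbit σ α => R F Γ n β.1)
      ⟨permComp σ.perm⁻¹ β.1, permComp_inv_mem σ β.2⟩)

/-- The subalgebra `R_{[α]}(Γ)^σ` of the fixed points of `σ`. -/
noncomputable def fixedSubalgebra (n : ℕ) (α : K →₀ ℕ) : Subalgebra F (ROrbit σ F n α) :=
  AlgHom.equalizer (sigma σ F n α) (AlgHom.id F _)

/-- The set `K^{[α]}`, the union of the `K^β` for `β ∈ [α]`. -/
def orbitTuples (n : ℕ) (α : K →₀ ℕ) : Set (Fin n → K) := ⋃ β ∈ orbit σ α, tuples n β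

noncomputable instance (n : ℕ) (α : K →₀ ℕ) : Fintype (orbitTuples σ n α) :=
  ((finite_orbit σ α).biUnion fun β _ => finite_tuples n β).fintype

theorem swapTuple_mem_orbitTuples {n : ℕ} {α : K →₀ ℕ} (a : ℕ) (ha : a + 1 < n)
    {k : Fin n → K} (hk : k ∈ orbitTuples σ n α) : swapTuple a ha k ∈ orbitTuples σ n α := by
  simp only [orbitTuples, Set.mem_iUnion] at hk ⊢
  obtain ⟨β, hβ, hk⟩ := hk
  exact ⟨β, hβ, swapTuple_mem a ha hk⟩

/-- The set `K^{[α]}_σ`, the quotient of `K^{[α]}` by the equivalence relation generated by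
`k ∼ σ(k)`. -/
def TupleOrbit (n : ℕ) (α : K →₀ ℕ) : Type _ :=
  Quot fun k k' : orbitTuples σ n α => k'.1 = σ.perm ∘ k.1

/-- The class of a tuple in `K^{[α]}_σ`. -/
def TupleOrbit.mk {n : ℕ} {α : K →₀ ℕ} (k : orbitTuples σ n α) : TupleOrbit σ n α :=
  Quot.mk _ k

noncomputable instance (n : ℕ) (α : K →₀ ℕ) : Fintype (TupleOrbit σ n α) :=
  haveI : Finite (TupleOrbit σ n α) :=
    Finite.of_surjective (TupleOrbit.mk σ) fun γ => Quot.exists_rep γ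
  Fintype.ofFinite _

/-- The index data of `K^{[α]}_σ`: the classes `s_a · γ`, and the conditions `γ_a = γ_b` and
"`(γ_a, γ_b)` is an edge", are read off any representative of `γ`. -/
def orbitData (n : ℕ) (α : K →₀ ℕ) : IndexData n (TupleOrbit σ n α) where
  swap a ha := Quot.map
    (fun k => ⟨swapTuple a ha k.1, swapTuple_mem_orbitTuples σ a ha k.2⟩)
    (fun k k' h => by simp [swapTuple, h, Function.comp_assoc])
  same a b := Quot.lift (fun k => k.1 a = k.1 b) (fun k k' h => by simp [h])
  edge a b := Quot.lift (fun k => Γ.Adj (k.1 a) (k.1 b))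
    (fun k k' h => by simp [h, ← σ.adj_iff])

/-- The algebra presented by generators `e(γ)` (`γ ∈ K^{[α]}_σ`), `y_1, …, y_n` and
`ψ_1, …, ψ_{n-1}`, and the relations of quiver Hecke type. -/
abbrev FixedPresentation (n : ℕ) (α : K →₀ ℕ) : Type _ := Alg F (orbitData σ n α)

open Classical in
/-- The idempotent `e(k)` of `R_{[α]}(Γ)`, for `k ∈ K^{[α]}`: its component in `R_β(Γ)` is `e(k)`
if `k ∈ K^β`, and `0` otherwise. -/
noncomputable def eTuple {n : ℕ} {α : K →₀ ℕ} (k : orbitTuples σ n α) : ROrbit σ F n α :=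
  fun β => if h : k.1 ∈ tuples n β.1 then e F (tupleData Γ n β.1) ⟨k.1, h⟩ else 0

open Classical in
/-- The element `e(γ)` of `R_{[α]}(Γ)`, the sum of the `e(k)` over the tuples `k ∈ γ`. -/
noncomputable def eOrbit {n : ℕ} {α : K →₀ ℕ} (γ : TupleOrbit σ n α) : ROrbit σ F n α :=
  ∑ k : orbitTuples σ n α with TupleOrbit.mk σ k = γ, eTuple σ F k

/-- The element `y_a` of `R_{[α]}(Γ)`. -/
noncomputable def yOrbit {n : ℕ} (α : K →₀ ℕ) (a : Fin n) : ROrbit σ F n α :=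
  fun β => y F (tupleData Γ n β.1) a

/-- The element `ψ_a` of `R_{[α]}(Γ)`. -/
noncomputable def psiOrbit {n : ℕ} (α : K →₀ ℕ) (a : Fin (n - 1)) : ROrbit σ F n α :=
  fun β => psi F (tupleData Γ n β.1) a

end FixedPoints

end QHA

/-!
# Fixed points of a free quiver automorphism on a quiver Hecke algebra

Write `B` for the algebra presented by the orbit idempotents `e(γ)`. The class map from `K^β` to
`K^{[α]}_σ` is a surjection compatible with the place permutations and with the conditions
`k_a = k_b` and `k_a → k_b` (`IsCovering`). Such a surjection `π` induces a homomorphism in the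
opposite direction between the presented algebras, which sends `e(γ)` to the sum of the `e(k)` over
the fibre at `γ` (`IsCovering.pullback`). Together, these homomorphisms for `β ∈ [α]` form
`toROrbit : B → R_{[α]}(Γ)`, with values fixed by `σ`.

Injectivity needs no basis theorem. The algebra `R_β(Γ)` acts on the functions `f` on `K^β` with
`f(k) ∈ e(π k) B`: the idempotent `e(k)` restricts to the point `k`, `y_a` multiplies the values by
`y_a`, and `(ψ_a f)(k) = ψ_a f(s_a k)`. Through the pullback, `b ∈ B` sends the function
`k ↦ e(π k)` to `k ↦ e(π k) b`. As `π` is surjective and `∑ e(γ) = 1`, the latter function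
determines `b` (`IsCovering.act_pullback_diagonal`, `IsCovering.pullback_injective`).

For surjectivity, let `tr = ∑ σ^m`, the sum over `0 ≤ m < p`. The action on tuples is free because
`n > 0`, so `tr (e(k)) = e([k])` (`trace_eTuple`); no division by `p` is involved. As `tr` is linear
over the fixed points and `e(k) y_a = y_a e(k)`, `e(k) ψ_a = ψ_a e(s_a k)`, every
`tr (e(k) a)` is in the range of `toROrbit` (`trace_eTuple_mul_mem`). A fixed point `r` is the sum
over the classes `γ = [k]` of the elements `e(γ) r = tr (e(k)) r = tr (e(k) r)`.
-/

namespace QHA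

/-! ### Relations in the presented algebra -/

section Presented

variable {F : Type*} [CommRing F] {n : ℕ} {X : Type*} [Fintype X] {D : IndexData n X}

@[simp] theorem mkAlgHom_fe (x : X) : RingQuot.mkAlgHom F (Rel F D) (fe F n x) = e F D x := rfl

@[simp] theorem mkAlgHom_fy (a : Fin n) :
    RingQuot.mkAlgHom F (Rel F D) (fy F X a) = y F D a := rfl

@[simp] theorem mkAlgHom_fpsi (a : Fin (n - 1)) :
    RingQuot.mkAlgHom F (Rel F D) (fpsi F X a) = psi F D a := rfl

theorem mkAlgHom_eq_of_rel {u v : FreeAlgebra F (Gen n X)} (h : Rel F D u v) :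
    RingQuot.mkAlgHom F (Rel F D) u = RingQuot.mkAlgHom F (Rel F D) v :=
  RingQuot.mkAlgHom_rel F h

theorem sum_e : ∑ x : X, e F D x = 1 := by
  simpa using mkAlgHom_eq_of_rel (Rel.sum_e (F := F) (D := D))

theorem e_mul_self (x : X) : e F D x * e F D x = e F D x := by
  simpa using mkAlgHom_eq_of_rel (Rel.e_mul_self (F := F) (D := D) x)

theorem e_mul_of_ne {x x' : X} (h : x ≠ x') : e F D x * e F D x' = 0 := by
  simpa using mkAlgHom_eq_of_rel (Rel.e_mul_ne (F := F) (D := D) x x' h)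

theorem y_mul_e (a : Fin n) (x : X) : y F D a * e F D x = e F D x * y F D a := by
  simpa using mkAlgHom_eq_of_rel (Rel.y_e (F := F) (D := D) a x)

theorem psi_mul_e (a : ℕ) (ha : a + 1 < n) (x : X) :
    psi F D ⟨a, by omega⟩ * e F D x = e F D (D.swap a ha x) * psi F D ⟨a, by omega⟩ := by
  simpa using mkAlgHom_eq_of_rel (Rel.psi_e (F := F) (D := D) a ha x)

/-- Multiplying a relation of the presented algebra on the right by `b`. -/
theorem mkAlgHom_mul_eq_of_rel {u v : FreeAlgebra F (Gen n X)} (h : Rel F D u v) (b : Alg F D) :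
    RingQuot.mkAlgHom F (Rel F D) u * b = RingQuot.mkAlgHom F (Rel F D) v * b := by
  rw [mkAlgHom_eq_of_rel h]

/-- Induction on the elements of the presented algebra, built from its generators. -/
theorem Alg.induction {P : Alg F D → Prop} (algebraMap : ∀ r : F, P (algebraMap F _ r))
    (he : ∀ x, P (e F D x)) (hy : ∀ a, P (y F D a)) (hpsi : ∀ a, P (psi F D a))
    (mul : ∀ a b, P a → P b → P (a * b)) (add : ∀ a b, P a → P b → P (a + b)) (b : Alg F D) :
    P b := by
  obtain ⟨u, rfl⟩ := RingQuot.mkAlgHom_surjective F (Rel F D) b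
  induction u using FreeAlgebra.induction with
  | grade0 r => simpa using algebraMap r
  | grade1 g =>
    match g with
    | Gen.e x => exact he x
    | Gen.y a => exact hy a
    | Gen.psi a => exact hpsi a
  | mul a b ha hb => simpa using mul _ _ ha hb
  | add a b ha hb => simpa using add _ _ ha hb

theorem Alg.hom_ext {A : Type*} [Semiring A] [Algebra F A] {f g : Alg F D →ₐ[F] A}
    (he : ∀ x, f (e F D x) = g (e F D x)) (hy : ∀ a, f (y F D a) = g (y F D a))
    (hpsi : ∀ a, f (psi F D a) = g (psi F D a)) : f = g := by
  refine AlgHom.ext fun b => ?_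
  induction b using Alg.induction with
  | algebraMap r => simp
  | he x => exact he x
  | hy a => exact hy a
  | hpsi a => exact hpsi a
  | mul a b ha hb => simp [ha, hb]
  | add a b ha hb => simp [ha, hb]

end Presented

/-! ### Coverings of index sets -/

/-- The identities satisfied by the place permutations `s_a` on a set of tuples: the Coxeter
relations, and the triviality of the transposition of two equal components. In `braid_of_same`, the
braid word is the transposition of the positions `a` and `a + 2`. -/
structure IndexData.IsPlaceAction {n : ℕ} {X : Type*} (D : IndexData n X) : Prop where
  swap_swap : ∀ a ha x, D.swap a ha (D.swap a ha x) = x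
  swap_of_same : ∀ (a : ℕ) (ha : a + 1 < n) (x : X),
    D.same ⟨a, by omega⟩ ⟨a + 1, ha⟩ x → D.swap a ha x = x
  swap_comm : ∀ (a b : ℕ) (ha : a + 1 < n) (hb : b + 1 < n) (x : X),
    a + 1 < b ∨ b + 1 < a → D.swap a ha (D.swap b hb x) = D.swap b hb (D.swap a ha x)
  braid : ∀ (a : ℕ) (ha : a + 2 < n) (x : X),
    D.swap (a + 1) ha (D.swap a (by omega) (D.swap (a + 1) ha x)) =
      D.swap a (by omega) (D.swap (a + 1) ha (D.swap a (by omega) x))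
  braid_of_same : ∀ (a : ℕ) (ha : a + 2 < n) (x : X), D.same ⟨a + 2, ha⟩ ⟨a, by omega⟩ x →
    D.swap (a + 1) ha (D.swap a (by omega) (D.swap (a + 1) ha x)) = x

/-- A surjection of index sets that is compatible with the index data. The fibres need not have the
same size. -/
structure IsCovering {n : ℕ} {X Y : Type*} (D : IndexData n X) (D' : IndexData n Y)
    (π : X → Y) : Prop where
  surjective : Function.Surjective π
  map_swap : ∀ a ha x, π (D.swap a ha x) = D'.swap a ha (π x)
  same_iff : ∀ a b x, D.same a b x ↔ D'.same a b (π x)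
  edge_iff : ∀ a b x, D.edge a b x ↔ D'.edge a b (π x)

namespace IsCovering

variable (F : Type*) [CommRing F] {n : ℕ} {X Y : Type*}
  {D : IndexData n X} {D' : IndexData n Y} {π : X → Y}

theorem swap_swap (hπ : IsCovering D D' π) (hD : D.IsPlaceAction) (a : ℕ) (ha : a + 1 < n)
    (z : Y) : D'.swap a ha (D'.swap a ha z) = z := by
  obtain ⟨x, rfl⟩ := hπ.surjective z
  rw [← hπ.map_swap, ← hπ.map_swap, hD.swap_swap]

section Pullback

variable [Fintype X]

variable (D π) in
open Classical in
/-- The sum of the idempotents `e(x)` over the fibre of `π` at `z`. -/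
noncomputable def fibreSum (z : Y) : Alg F D := ∑ x : X with π x = z, e F D x

variable (D π) in
/-- The homomorphism of free algebras behind `IsCovering.pullback`. -/
noncomputable def freePullback : FreeAlgebra F (Gen n Y) →ₐ[F] Alg F D :=
  FreeAlgebra.lift F fun g => match g with
    | Gen.e z => fibreSum F D π z
    | Gen.y a => y F D a
    | Gen.psi a => psi F D a

@[simp] theorem freePullback_fe (z : Y) :
    freePullback F D π (fe F n z) = fibreSum F D π z := by simp [freePullback, fe]

@[simp] theorem freePullback_fy (a : Fin n) :
    freePullback F D π (fy F Y a) = y F D a := by simp [freePullback, fy]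

@[simp] theorem freePullback_fpsi (a : Fin (n - 1)) :
    freePullback F D π (fpsi F Y a) = psi F D a := by simp [freePullback, fpsi]

/-- The relations of the form `u e(z) = v e(z)` can be checked on the summands of the image of
`e(z)`. -/
theorem freePullback_mul_fe_congr {u v : FreeAlgebra F (Gen n Y)} {z : Y}
    (h : ∀ x, π x = z → freePullback F D π u * e F D x = freePullback F D π v * e F D x) :
    freePullback F D π (u * fe F n z) = freePullback F D π (v * fe F n z) := by
  simp only [map_mul, freePullback_fe, fibreSum, Finset.mul_sum]
  exact Finset.sum_congr rfl fun x hx => h x (by simpa using hx)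

open Classical in
theorem e_mul_fibreSum (x : X) (z : Y) :
    e F D x * fibreSum F D π z = if π x = z then e F D x else 0 := by
  have h : ∀ x', e F D x * e F D x' = if x = x' then e F D x else 0 := fun x' => by
    split_ifs with h
    · rw [← h, e_mul_self]
    · exact e_mul_of_ne h
  simp [fibreSum, Finset.mul_sum, h, Finset.sum_ite_eq]

theorem psi_mul_fibreSum (hπ : IsCovering D D' π) (hD : D.IsPlaceAction) (a : ℕ)
    (ha : a + 1 < n) (z : Y) :
    psi F D ⟨a, by omega⟩ * fibreSum F D π z =
      fibreSum F D π (D'.swap a ha z) * psi F D ⟨a, by omega⟩ := by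
  classical
  simp only [fibreSum, Finset.mul_sum, Finset.sum_mul, psi_mul_e a ha]
  refine Finset.sum_bij' (fun x _ => D.swap a ha x) (fun x _ => D.swap a ha x) ?_ ?_ ?_ ?_ ?_
  · intro x hx
    simp only [Finset.mem_filter, Finset.mem_univ, true_and] at hx ⊢
    rw [hπ.map_swap, hx]
  · intro x hx
    simp only [Finset.mem_filter, Finset.mem_univ, true_and] at hx ⊢
    rw [hπ.map_swap, hx, hπ.swap_swap hD]
  · intro x _; exact hD.swap_swap _ _ _
  · intro x _; exact hD.swap_swap _ _ _
  · intro x _; rfl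

open Classical in
theorem fibreSum_mul_fibreSum (z z' : Y) :
    fibreSum F D π z * fibreSum F D π z' = if z = z' then fibreSum F D π z else 0 := by
  have h : ∀ x ∈ Finset.univ.filter (π · = z),
      e F D x * fibreSum F D π z' = if z = z' then e F D x else 0 := fun x hx => by
    rw [e_mul_fibreSum, (Finset.mem_filter.1 hx).2]
  conv_lhs => rw [fibreSum, Finset.sum_mul, Finset.sum_congr rfl h]
  split_ifs
  · rfl
  · exact Finset.sum_const_zero

theorem freePullback_eq_of_rel [Fintype Y] (hπ : IsCovering D D' π) (hD : D.IsPlaceAction)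
    {u v : FreeAlgebra F (Gen n Y)} (h : Rel F D' u v) :
    freePullback F D π u = freePullback F D π v := by
  classical
  cases h with
  | sum_e =>
    simp only [map_sum, freePullback_fe, map_one, ← sum_e (F := F) (D := D)]
    exact Finset.sum_fiberwise _ _ _
  | e_mul_self z => simp [fibreSum_mul_fibreSum]
  | e_mul_ne z z' h => simp [fibreSum_mul_fibreSum, h]
  | y_e a z => simp [fibreSum, Finset.mul_sum, Finset.sum_mul, y_mul_e]
  | psi_e a ha z => simpa using psi_mul_fibreSum F hπ hD a ha z
  | y_y a b => simpa using mkAlgHom_eq_of_rel (Rel.y_y (F := F) (D := D) a b)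
  | psi_y a b h h' => simpa using mkAlgHom_eq_of_rel (Rel.psi_y (F := F) (D := D) a b h h')
  | psi_psi a b h => simpa using mkAlgHom_eq_of_rel (Rel.psi_psi (F := F) (D := D) a b h)
  | psi_y_succ_same a ha z h =>
    refine freePullback_mul_fe_congr F fun x hx => ?_
    subst hx
    simpa using mkAlgHom_eq_of_rel (Rel.psi_y_succ_same (F := F) (D := D) a ha x
      ((hπ.same_iff _ _ _).2 h))
  | psi_y_succ_ne a ha z h =>
    refine freePullback_mul_fe_congr F fun x hx => ?_
    subst hx
    simpa using mkAlgHom_eq_of_rel (Rel.psi_y_succ_ne (F := F) (D := D) a ha x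
      (fun k => h ((hπ.same_iff _ _ _).1 k)))
  | y_succ_psi_same a ha z h =>
    refine freePullback_mul_fe_congr F fun x hx => ?_
    subst hx
    simpa using mkAlgHom_eq_of_rel (Rel.y_succ_psi_same (F := F) (D := D) a ha x
      ((hπ.same_iff _ _ _).2 h))
  | y_succ_psi_ne a ha z h =>
    refine freePullback_mul_fe_congr F fun x hx => ?_
    subst hx
    simpa using mkAlgHom_eq_of_rel (Rel.y_succ_psi_ne (F := F) (D := D) a ha x
      (fun k => h ((hπ.same_iff _ _ _).1 k)))
  | psi_sq_same a ha z h =>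
    rw [← zero_mul (fe F n z)]
    refine freePullback_mul_fe_congr F fun x hx => ?_
    subst hx
    simpa using mkAlgHom_eq_of_rel (Rel.psi_sq_same (F := F) (D := D) a ha x
      ((hπ.same_iff _ _ _).2 h))
  | psi_sq_none a ha z h h₁ h₂ =>
    conv_rhs => rw [← one_mul (fe F n z)]
    refine freePullback_mul_fe_congr F fun x hx => ?_
    subst hx
    simpa using mkAlgHom_eq_of_rel (Rel.psi_sq_none (F := F) (D := D) a ha x
      (fun k => h ((hπ.same_iff _ _ _).1 k))
      (fun k => h₁ ((hπ.edge_iff _ _ _).1 k))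
      (fun k => h₂ ((hπ.edge_iff _ _ _).1 k)))
  | psi_sq_right a ha z h₁ h₂ =>
    refine freePullback_mul_fe_congr F fun x hx => ?_
    subst hx
    simpa using mkAlgHom_eq_of_rel (Rel.psi_sq_right (F := F) (D := D) a ha x
      ((hπ.edge_iff _ _ _).2 h₁)
      (fun k => h₂ ((hπ.edge_iff _ _ _).1 k)))
  | psi_sq_left a ha z h₁ h₂ =>
    refine freePullback_mul_fe_congr F fun x hx => ?_
    subst hx
    simpa using mkAlgHom_eq_of_rel (Rel.psi_sq_left (F := F) (D := D) a ha x
      (fun k => h₁ ((hπ.edge_iff _ _ _).1 k))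
      ((hπ.edge_iff _ _ _).2 h₂))
  | psi_sq_both a ha z h₁ h₂ =>
    refine freePullback_mul_fe_congr F fun x hx => ?_
    subst hx
    simpa using mkAlgHom_eq_of_rel (Rel.psi_sq_both (F := F) (D := D) a ha x
      ((hπ.edge_iff _ _ _).2 h₁)
      ((hπ.edge_iff _ _ _).2 h₂))
  | braid_right a ha z h h₁ h₂ =>
    refine freePullback_mul_fe_congr F fun x hx => ?_
    subst hx
    simpa using mkAlgHom_eq_of_rel (Rel.braid_right (F := F) (D := D) a ha x
      ((hπ.same_iff _ _ _).2 h)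
      ((hπ.edge_iff _ _ _).2 h₁)
      (fun k => h₂ ((hπ.edge_iff _ _ _).1 k)))
  | braid_left a ha z h h₁ h₂ =>
    refine freePullback_mul_fe_congr F fun x hx => ?_
    subst hx
    simpa using mkAlgHom_eq_of_rel (Rel.braid_left (F := F) (D := D) a ha x
      ((hπ.same_iff _ _ _).2 h)
      (fun k => h₁ ((hπ.edge_iff _ _ _).1 k))
      ((hπ.edge_iff _ _ _).2 h₂))
  | braid_both a ha z h h₁ h₂ =>
    refine freePullback_mul_fe_congr F fun x hx => ?_
    subst hx
    simpa [map_ofNat] using mkAlgHom_eq_of_rel (Rel.braid_both (F := F) (D := D) a ha x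
      ((hπ.same_iff _ _ _).2 h)
      ((hπ.edge_iff _ _ _).2 h₁)
      ((hπ.edge_iff _ _ _).2 h₂))
  | braid_otherwise a ha z h =>
    refine freePullback_mul_fe_congr F fun x hx => ?_
    subst hx
    simp only [← hπ.same_iff, ← hπ.edge_iff] at h
    simpa using mkAlgHom_eq_of_rel (Rel.braid_otherwise (F := F) (D := D) a ha x h)

/-- The homomorphism `e(z) ↦ ∑ e(x)`, the sum over the fibre of `π` at `z`, with `y_a ↦ y_a` and
`ψ_a ↦ ψ_a`. -/
noncomputable def pullback [Fintype Y] (hπ : IsCovering D D' π) (hD : D.IsPlaceAction) :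
    Alg F D' →ₐ[F] Alg F D :=
  RingQuot.liftAlgHom F ⟨freePullback F D π, fun _ _ h => freePullback_eq_of_rel F hπ hD h⟩

variable [Fintype Y] (hπ : IsCovering D D' π) (hD : D.IsPlaceAction)

@[simp] theorem pullback_e (z : Y) : pullback F hπ hD (e F D' z) = fibreSum F D π z :=
  (RingQuot.liftAlgHom_mkAlgHom_apply F _ _ _).trans (by simp)

@[simp] theorem pullback_y (a : Fin n) : pullback F hπ hD (y F D' a) = y F D a :=
  (RingQuot.liftAlgHom_mkAlgHom_apply F _ _ _).trans (by simp)

@[simp] theorem pullback_psi (a : Fin (n - 1)) : pullback F hπ hD (psi F D' a) = psi F D a :=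
  (RingQuot.liftAlgHom_mkAlgHom_apply F _ _ _).trans (by simp)

end Pullback

/-! ### The module that detects the kernel of the pullback -/

section Representation

variable [Fintype Y]

variable (D' π) in
/-- The functions `f : X → Alg F D'` with `f x ∈ e(π x) · Alg F D'` for all `x`; the condition is
written as `e(π x) f x = f x`. -/
def sections : Submodule F (X → Alg F D') where
  carrier := {f | ∀ x, e F D' (π x) * f x = f x}
  add_mem' hf hg x := by simp [mul_add, hf x, hg x]
  zero_mem' x := by simp
  smul_mem' c f hf x := by simp [hf x]

variable {F} in
theorem e_mul_apply (f : sections F D' π) (x : X) : e F D' (π x) * f.1 x = f.1 x := f.2 x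

variable (D' π) in
open Classical in
/-- The section supported at `x` with value `e(π x) b`. -/
noncomputable def single (x : X) : Alg F D' →ₗ[F] sections F D' π where
  toFun b := ⟨Pi.single x (e F D' (π x) * b), fun x' => by
    rcases eq_or_ne x' x with rfl | h
    · simp [← mul_assoc, e_mul_self]
    · simp [h]⟩
  map_add' b c := by ext; simp [mul_add, Pi.single_add]
  map_smul' r b := by ext; simp [Pi.single_smul]

open Classical in
theorem single_apply (x x' : X) (b : Alg F D') :
    (single F D' π x b).1 x' = if x' = x then e F D' (π x) * b else 0 := by
  simp [single, Pi.single_apply]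

variable (D' π) in
/-- The operator by which `e(x)` acts on `sections`: restriction to the point `x`. -/
noncomputable def eOp (x : X) : Module.End F (sections F D' π) :=
  single F D' π x ∘ₗ LinearMap.proj x ∘ₗ (sections F D' π).subtype

theorem eOp_apply (x : X) (f : sections F D' π) :
    eOp F D' π x f = single F D' π x (f.1 x) := rfl

variable (D' π) in
/-- The operator by which `y_a` acts on `sections`. -/
noncomputable def yOp (a : Fin n) : Module.End F (sections F D' π) where
  toFun f := ⟨fun x => y F D' a * f.1 x, fun x => by
    rw [← mul_assoc, ← y_mul_e, mul_assoc, e_mul_apply]⟩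
  map_add' f g := by ext; simp [mul_add]
  map_smul' c f := by ext; simp

@[simp] theorem yOp_apply (a : Fin n) (f : sections F D' π) (x : X) :
    (yOp F D' π a f).1 x = y F D' a * f.1 x := rfl

theorem yOp_sub (a : Fin n) (f g : sections F D' π) :
    yOp F D' π a (f - g) = yOp F D' π a f - yOp F D' π a g := by
  ext x
  simp [mul_sub]

variable (hπ : IsCovering D D' π) (hD : D.IsPlaceAction)

/-- The operator by which `ψ_a` acts on `sections`: the value of `ψ_a f` at `x` is
`ψ_a f(s_a · x)`. -/
noncomputable def psiOp (a : Fin (n - 1)) : Module.End F (sections F D' π) where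
  toFun f := ⟨fun x => psi F D' a * f.1 (D.swap a.1 (by omega) x), fun x => by
    have h := psi_mul_e (F := F) (D := D') a.1 (by omega) (π (D.swap a.1 (by omega) x))
    rw [← hπ.map_swap, hD.swap_swap] at h
    rw [← mul_assoc, ← h, mul_assoc, e_mul_apply]⟩
  map_add' f g := by ext; simp [mul_add]
  map_smul' c f := by ext; simp

@[simp] theorem psiOp_apply (a : Fin (n - 1)) (f : sections F D' π) (x : X) :
    (psiOp F hπ hD a f).1 x = psi F D' a * f.1 (D.swap a.1 (by omega) x) := rfl

theorem yOp_single (a : Fin n) (x : X) (b : Alg F D') :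
    yOp F D' π a (single F D' π x b) = single F D' π x (y F D' a * b) := by
  ext x'
  rw [yOp_apply, single_apply, single_apply]
  split_ifs <;> simp [← mul_assoc, y_mul_e]

theorem psiOp_single (a : ℕ) (ha : a < n - 1) (x : X) (b : Alg F D') :
    psiOp F hπ hD ⟨a, ha⟩ (single F D' π x b) =
      single F D' π (D.swap a (by omega) x) (psi F D' ⟨a, ha⟩ * b) := by
  ext x'
  have h : D.swap a (by omega) x' = x ↔ x' = D.swap a (by omega) x :=
    ⟨fun h => by rw [← h, hD.swap_swap], fun h => by rw [h, hD.swap_swap]⟩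
  rw [psiOp_apply, single_apply, single_apply]
  by_cases hx : D.swap a (by omega) x' = x
  · rw [if_pos hx, if_pos (h.1 hx), ← mul_assoc, ← mul_assoc, psi_mul_e a (by omega), hπ.map_swap]
  · rw [if_neg hx, if_neg (mt h.2 hx), mul_zero]

/-- The action of the free algebra on `sections`. -/
noncomputable def freeAct : FreeAlgebra F (Gen n X) →ₐ[F] Module.End F (sections F D' π) :=
  FreeAlgebra.lift F fun g => match g with
    | Gen.e x => eOp F D' π x
    | Gen.y a => yOp F D' π a
    | Gen.psi a => psiOp F hπ hD a

@[simp] theorem freeAct_fe (x : X) : freeAct F hπ hD (fe F n x) = eOp F D' π x := by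
  simp [freeAct, fe]

@[simp] theorem freeAct_fy (a : Fin n) : freeAct F hπ hD (fy F X a) = yOp F D' π a := by
  simp [freeAct, fy]

@[simp] theorem freeAct_fpsi (a : Fin (n - 1)) :
    freeAct F hπ hD (fpsi F X a) = psiOp F hπ hD a := by
  simp [freeAct, fpsi]

@[simp] theorem freeAct_sub_apply (u v : FreeAlgebra F (Gen n X)) (f : sections F D' π) :
    freeAct F hπ hD (u - v) f = freeAct F hπ hD u f - freeAct F hπ hD v f := by
  have h : freeAct F hπ hD (u - v) f + freeAct F hπ hD v f = freeAct F hπ hD u f := by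
    rw [← LinearMap.add_apply, ← map_add, sub_add_cancel]
  ext x
  exact eq_sub_of_add_eq (congrFun (congrArg Subtype.val h) x)

/-- Two elements `u e(x)` and `v e(x)` act in the same way as soon as `u` and `v` agree on the
sections supported at `x`. -/
theorem freeAct_mul_fe_congr {u v : FreeAlgebra F (Gen n X)} {x : X}
    (h : ∀ b, freeAct F hπ hD u (single F D' π x (e F D' (π x) * b)) =
      freeAct F hπ hD v (single F D' π x (e F D' (π x) * b))) :
    freeAct F hπ hD (u * fe F n x) = freeAct F hπ hD (v * fe F n x) := by
  ext1 f
  simpa [eOp_apply, e_mul_apply] using h (f.1 x)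

variable [Fintype X]

/-- The relations hold for the operators on `sections`. Those involving an `e(x)` reduce to the same
relation in `Alg F D'`, multiplied on the right by an element of `Alg F D'`, once the place
permutations on both sides are known to move `x` to the same point. -/
theorem freeAct_eq_of_rel {u v : FreeAlgebra F (Gen n X)} (h : Rel F D u v) :
    freeAct F hπ hD u = freeAct F hπ hD v := by
  classical
  cases h with
  | sum_e =>
    ext f x
    simp [eOp_apply, single_apply, e_mul_apply]
  | e_mul_self x =>
    ext f x'
    simp [eOp_apply, single_apply, e_mul_apply]
  | e_mul_ne x x' h =>
    ext f x''
    simp [eOp_apply, single_apply, h]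
  | y_e a x =>
    ext1 f
    simp [eOp_apply, yOp_single]
  | psi_e a ha x =>
    ext1 f
    simp [eOp_apply, psiOp_single, hD.swap_swap]
  | y_y a b =>
    ext f x
    simpa [mul_assoc] using mkAlgHom_mul_eq_of_rel (Rel.y_y (F := F) (D := D') a b) (f.1 x)
  | psi_y a b h h' =>
    ext f x
    simpa [mul_assoc] using mkAlgHom_mul_eq_of_rel (Rel.psi_y (F := F) (D := D') a b h h')
      (f.1 (D.swap a.1 (by omega) x))
  | psi_psi a b h =>
    ext f x
    simpa [mul_assoc, hD.swap_comm b.1 a.1 _ _ _ h.symm] using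
      mkAlgHom_mul_eq_of_rel (Rel.psi_psi (F := F) (D := D') a b h)
        (f.1 (D.swap a.1 (by omega) (D.swap b.1 (by omega) x)))
  | psi_y_succ_same a ha x h =>
    refine freeAct_mul_fe_congr F hπ hD fun b => ?_
    have key := congrArg (single F D' π x)
      (mkAlgHom_mul_eq_of_rel (Rel.psi_y_succ_same (F := F) (D := D') a ha (π x)
        ((hπ.same_iff _ _ _).1 h)) b)
    simpa [add_mul, mul_assoc, psiOp_single, yOp_single, hD.swap_of_same a ha x h] using key
  | psi_y_succ_ne a ha x h =>
    refine freeAct_mul_fe_congr F hπ hD fun b => ?_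
    have key := congrArg (single F D' π (D.swap a ha x))
      (mkAlgHom_mul_eq_of_rel (Rel.psi_y_succ_ne (F := F) (D := D') a ha (π x)
        (fun k => h ((hπ.same_iff _ _ _).2 k))) b)
    simpa [mul_assoc, psiOp_single, yOp_single] using key
  | y_succ_psi_same a ha x h =>
    refine freeAct_mul_fe_congr F hπ hD fun b => ?_
    have key := congrArg (single F D' π x)
      (mkAlgHom_mul_eq_of_rel (Rel.y_succ_psi_same (F := F) (D := D') a ha (π x)
        ((hπ.same_iff _ _ _).1 h)) b)
    simpa [add_mul, mul_assoc, psiOp_single, yOp_single, hD.swap_of_same a ha x h] using key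
  | y_succ_psi_ne a ha x h =>
    refine freeAct_mul_fe_congr F hπ hD fun b => ?_
    have key := congrArg (single F D' π (D.swap a ha x))
      (mkAlgHom_mul_eq_of_rel (Rel.y_succ_psi_ne (F := F) (D := D') a ha (π x)
        (fun k => h ((hπ.same_iff _ _ _).2 k))) b)
    simpa [mul_assoc, psiOp_single, yOp_single] using key
  | psi_sq_same a ha x h =>
    rw [← zero_mul (fe F n x)]
    refine freeAct_mul_fe_congr F hπ hD fun b => ?_
    have key := congrArg (single F D' π x)
      (mkAlgHom_mul_eq_of_rel (Rel.psi_sq_same (F := F) (D := D') a ha (π x)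
        ((hπ.same_iff _ _ _).1 h)) b)
    simpa [pow_two, mul_assoc, psiOp_single, hD.swap_swap] using key
  | psi_sq_none a ha x h h₁ h₂ =>
    conv_rhs => rw [← one_mul (fe F n x)]
    refine freeAct_mul_fe_congr F hπ hD fun b => ?_
    have key := congrArg (single F D' π x)
      (mkAlgHom_mul_eq_of_rel (Rel.psi_sq_none (F := F) (D := D') a ha (π x)
        (fun k => h ((hπ.same_iff _ _ _).2 k))
        (fun k => h₁ ((hπ.edge_iff _ _ _).2 k))
        (fun k => h₂ ((hπ.edge_iff _ _ _).2 k))) b)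
    simpa [pow_two, mul_assoc, psiOp_single, hD.swap_swap] using key
  | psi_sq_right a ha x h₁ h₂ =>
    refine freeAct_mul_fe_congr F hπ hD fun b => ?_
    have key := congrArg (single F D' π x)
      (mkAlgHom_mul_eq_of_rel (Rel.psi_sq_right (F := F) (D := D') a ha (π x)
        ((hπ.edge_iff _ _ _).1 h₁)
        (fun k => h₂ ((hπ.edge_iff _ _ _).2 k))) b)
    simpa [pow_two, sub_mul, mul_assoc, psiOp_single, yOp_single, hD.swap_swap] using key
  | psi_sq_left a ha x h₁ h₂ =>
    refine freeAct_mul_fe_congr F hπ hD fun b => ?_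
    have key := congrArg (single F D' π x)
      (mkAlgHom_mul_eq_of_rel (Rel.psi_sq_left (F := F) (D := D') a ha (π x)
        (fun k => h₁ ((hπ.edge_iff _ _ _).2 k))
        ((hπ.edge_iff _ _ _).1 h₂)) b)
    simpa [pow_two, sub_mul, mul_assoc, psiOp_single, yOp_single, hD.swap_swap] using key
  | psi_sq_both a ha x h₁ h₂ =>
    refine freeAct_mul_fe_congr F hπ hD fun b => ?_
    have key := congrArg (single F D' π x)
      (mkAlgHom_mul_eq_of_rel (Rel.psi_sq_both (F := F) (D := D') a ha (π x)
        ((hπ.edge_iff _ _ _).1 h₁)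
        ((hπ.edge_iff _ _ _).1 h₂)) b)
    simpa [pow_two, mul_assoc, sub_mul, mul_sub, yOp_sub, psiOp_single, yOp_single,
      hD.swap_swap] using key
  | braid_right a ha x h h₁ h₂ =>
    refine freeAct_mul_fe_congr F hπ hD fun b => ?_
    have key := congrArg (single F D' π x)
      (mkAlgHom_mul_eq_of_rel (Rel.braid_right (F := F) (D := D') a ha (π x)
        ((hπ.same_iff _ _ _).1 h)
        ((hπ.edge_iff _ _ _).1 h₁)
        (fun k => h₂ ((hπ.edge_iff _ _ _).2 k))) b)
    simpa [sub_mul, mul_assoc, psiOp_single, hD.braid_of_same a ha x h,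
      ← hD.braid a ha x] using key
  | braid_left a ha x h h₁ h₂ =>
    refine freeAct_mul_fe_congr F hπ hD fun b => ?_
    have key := congrArg (single F D' π x)
      (mkAlgHom_mul_eq_of_rel (Rel.braid_left (F := F) (D := D') a ha (π x)
        ((hπ.same_iff _ _ _).1 h)
        (fun k => h₁ ((hπ.edge_iff _ _ _).2 k))
        ((hπ.edge_iff _ _ _).1 h₂)) b)
    simpa [add_mul, mul_assoc, psiOp_single, hD.braid_of_same a ha x h,
      ← hD.braid a ha x] using key
  | braid_both a ha x h h₁ h₂ =>
    refine freeAct_mul_fe_congr F hπ hD fun b => ?_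
    have key := congrArg (single F D' π x)
      (mkAlgHom_mul_eq_of_rel (Rel.braid_both (F := F) (D := D') a ha (π x)
        ((hπ.same_iff _ _ _).1 h)
        ((hπ.edge_iff _ _ _).1 h₁)
        ((hπ.edge_iff _ _ _).1 h₂)) b)
    simpa [two_mul, add_mul, sub_mul, mul_assoc, psiOp_single, yOp_single,
      hD.braid_of_same a ha x h, ← hD.braid a ha x] using key
  | braid_otherwise a ha x h =>
    refine freeAct_mul_fe_congr F hπ hD fun b => ?_
    simp only [hπ.same_iff, hπ.edge_iff] at h
    have key := congrArg
      (single F D' π (D.swap a (by omega) (D.swap (a + 1) ha (D.swap a (by omega) x))))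
      (mkAlgHom_mul_eq_of_rel (Rel.braid_otherwise (F := F) (D := D') a ha (π x) h) b)
    simpa [mul_assoc, psiOp_single, hD.braid a ha x] using key

/-- The action of `Alg F D` on `sections`. -/
noncomputable def act : Alg F D →ₐ[F] Module.End F (sections F D' π) :=
  RingQuot.liftAlgHom F ⟨freeAct F hπ hD, fun _ _ h => freeAct_eq_of_rel F hπ hD h⟩

theorem act_e (x : X) : act F hπ hD (e F D x) = eOp F D' π x :=
  (RingQuot.liftAlgHom_mkAlgHom_apply F _ _ _).trans (by simp)

theorem act_y (a : Fin n) : act F hπ hD (y F D a) = yOp F D' π a :=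
  (RingQuot.liftAlgHom_mkAlgHom_apply F _ _ _).trans (by simp)

theorem act_psi (a : Fin (n - 1)) : act F hπ hD (psi F D a) = psiOp F hπ hD a :=
  (RingQuot.liftAlgHom_mkAlgHom_apply F _ _ _).trans (by simp)

variable (D' π) in
/-- The section `x ↦ e(π x) b`. -/
def diagonal (b : Alg F D') : sections F D' π :=
  ⟨fun x => e F D' (π x) * b, fun x => by rw [← mul_assoc, e_mul_self]⟩

/-- Through the pullback, `Alg F D'` acts on the diagonal sections by left multiplication. -/
theorem act_pullback_diagonal (b c : Alg F D') :
    act F hπ hD (pullback F hπ hD b) (diagonal F D' π c) = diagonal F D' π (b * c) := by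
  classical
  induction b using Alg.induction generalizing c with
  | algebraMap r =>
    ext x
    simp [diagonal, Algebra.algebraMap_eq_smul_one]
  | he z =>
    ext x
    rw [pullback_e, fibreSum, map_sum]
    by_cases hx : π x = z
    · simp [act_e, eOp_apply, single_apply, diagonal, hx, ← mul_assoc, e_mul_self]
    · simp [act_e, eOp_apply, single_apply, diagonal, hx, ← mul_assoc, e_mul_of_ne]
  | hy a =>
    ext x
    simp [act_y, diagonal, ← mul_assoc, y_mul_e]
  | hpsi a =>
    ext x
    have h := psi_mul_e (F := F) (D := D') a.1 (by omega) (π (D.swap a.1 (by omega) x))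
    rw [← hπ.map_swap, hD.swap_swap] at h
    simp [act_psi, diagonal, ← mul_assoc, ← h]
  | mul a b ha hb => simp [ha, hb, mul_assoc]
  | add a b ha hb =>
    rw [map_add, map_add, LinearMap.add_apply, ha, hb]
    ext x
    simp [diagonal, add_mul, mul_add]

/-- The pullback is injective: the diagonal section of `1` recovers `e(z) b`, for every `z`, from
the action of the image of `b`. -/
theorem pullback_injective : Function.Injective (pullback F hπ hD) := by
  refine (injective_iff_map_eq_zero _).2 fun b hb => ?_
  have h := act_pullback_diagonal F hπ hD b 1
  rw [hb, map_zero, LinearMap.zero_apply, mul_one] at h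
  rw [← one_mul b, ← sum_e, Finset.sum_mul]
  refine Finset.sum_eq_zero fun z _ => ?_
  obtain ⟨x, rfl⟩ := hπ.surjective z
  exact (congrFun (congrArg Subtype.val h) x).symm

end Representation

end IsCovering

/-! ### Tuples and their orbits -/

section Orbits

variable {K : Type*} {Γ : Digraph K} {n : ℕ}

theorem comp_swap_eq_self {ι : Type*} [DecidableEq ι] {k : ι → K} {i j : ι} (h : k i = k j) :
    k ∘ Equiv.swap i j = k := by
  funext b
  rw [Function.comp_apply, Equiv.swap_apply_def]
  split_ifs with h₁ h₂
  · rw [h₁, h]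
  · rw [h₂, h]
  · rfl

theorem swapTuple_braid (a : ℕ) (ha : a + 2 < n) (k : Fin n → K) :
    swapTuple (a + 1) ha (swapTuple a (by omega) (swapTuple (a + 1) ha k)) =
      k ∘ Equiv.swap ⟨a + 2, ha⟩ ⟨a, by omega⟩ := by
  rw [← Equiv.swap_mul_swap_mul_swap (x := (⟨a, by omega⟩ : Fin n)) (y := ⟨a + 1, by omega⟩)
    (z := ⟨a + 2, ha⟩) (by simp) (by simp)]
  rfl

/-- The other braid word for the transposition of the positions `a` and `a + 2`. -/
theorem swapTuple_braid' (a : ℕ) (ha : a + 2 < n) (k : Fin n → K) :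
    swapTuple a (by omega) (swapTuple (a + 1) ha (swapTuple a (by omega) k)) =
      k ∘ Equiv.swap ⟨a + 2, ha⟩ ⟨a, by omega⟩ := by
  rw [Equiv.swap_comm, ← Equiv.swap_mul_swap_mul_swap (x := (⟨a + 2, ha⟩ : Fin n))
    (y := ⟨a + 1, by omega⟩) (z := ⟨a, by omega⟩) (by simp) (by simp),
    Equiv.swap_comm (⟨a + 1, by omega⟩ : Fin n) ⟨a, by omega⟩,
    Equiv.swap_comm (⟨a + 2, ha⟩ : Fin n) ⟨a + 1, by omega⟩]
  rfl

theorem isPlaceAction_tupleData (Γ : Digraph K) (n : ℕ) (α : K →₀ ℕ) :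
    (tupleData Γ n α).IsPlaceAction where
  swap_swap a ha k := by
    ext1
    funext b
    simp [tupleData, swapTuple]
  swap_of_same a ha k h := Subtype.ext (comp_swap_eq_self h)
  swap_comm a b ha hb k h := by
    have hd : Equiv.Perm.Disjoint (Equiv.swap (⟨b, by omega⟩ : Fin n) ⟨b + 1, hb⟩)
        (Equiv.swap ⟨a, by omega⟩ ⟨a + 1, ha⟩) :=
      Equiv.Perm.disjoint_swap_swap (by simp [Fin.ext_iff]; omega)
    exact Subtype.ext (congrArg (fun τ : Equiv.Perm (Fin n) => k.1 ∘ τ) hd.commute.eq)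
  braid a ha k := Subtype.ext ((swapTuple_braid a ha k.1).trans (swapTuple_braid' a ha k.1).symm)
  braid_of_same a ha k h :=
    Subtype.ext ((swapTuple_braid a ha k.1).trans (comp_swap_eq_self h))

variable {p : ℕ} (σ : FreeAut Γ p) {α : K →₀ ℕ}

theorem FreeAut.perm_pow_eq_one {p : ℕ} (σ : FreeAut Γ p) : σ.perm ^ p = 1 := Equiv.ext σ.pow_eq

theorem FreeAut.exists_pow_eq_zpow (m : ℤ) : ∃ j < p, σ.perm ^ m = σ.perm ^ j := by
  have hp : (0 : ℤ) < p := by exact_mod_cast σ.pos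
  obtain ⟨j, hj⟩ := Int.eq_ofNat_of_zero_le (Int.emod_nonneg m hp.ne')
  refine ⟨j, by have := Int.emod_lt_of_pos m hp; omega, ?_⟩
  rw [zpow_eq_zpow_emod (n := (p : ℤ)) m (by rw [zpow_natCast, σ.perm_pow_eq_one]), hj,
    zpow_natCast]

theorem comp_mem_orbitTuples {k : Fin n → K} (hk : k ∈ orbitTuples σ n α) :
    σ.perm ∘ k ∈ orbitTuples σ n α := by
  simp only [orbitTuples, Set.mem_iUnion] at hk ⊢
  obtain ⟨β, hβ, hk⟩ := hk
  refine ⟨permComp σ.perm β, permComp_mem σ hβ, (comp_mem_iff σ.perm _ k).1 ?_⟩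
  convert hk using 2
  ext x
  simp [permComp_apply]

/-- The map `k ↦ σ(k)` on `K^{[α]}`. -/
def shift (k : orbitTuples σ n α) : orbitTuples σ n α :=
  ⟨σ.perm ∘ k.1, comp_mem_orbitTuples σ k.2⟩

theorem coe_shift_iterate (m : ℕ) (k : orbitTuples σ n α) :
    ((shift σ)^[m] k).1 = ⇑(σ.perm ^ m) ∘ k.1 := by
  induction m with
  | zero => rfl
  | succ m ih =>
    rw [Function.iterate_succ_apply', pow_succ', Equiv.Perm.coe_mul, Function.comp_assoc, ← ih]
    rfl

theorem shift_bijective : Function.Bijective (shift σ : orbitTuples σ n α → _) :=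
  Finite.injective_iff_bijective.1 fun _ _ h =>
    Subtype.ext (σ.perm.injective.comp_left (congrArg Subtype.val h))

theorem mk_shift (k : orbitTuples σ n α) : TupleOrbit.mk σ (shift σ k) = TupleOrbit.mk σ k :=
  Eq.symm (Quot.sound (r := fun k k' : orbitTuples σ n α => k'.1 = σ.perm ∘ k.1) rfl)

theorem mk_shift_iterate (m : ℕ) (k : orbitTuples σ n α) :
    TupleOrbit.mk σ ((shift σ)^[m] k) = TupleOrbit.mk σ k := by
  induction m with
  | zero => rfl
  | succ m ih => rw [Function.iterate_succ_apply', mk_shift, ih]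

/-- The equivalence relation generated by `k ∼ σ(k)` is made explicit: as `σ ^ p = 1`, the class of
`k` consists of the `σ^m(k)` with `0 ≤ m < p`. -/
theorem mk_eq_mk_iff {k k' : orbitTuples σ n α} :
    TupleOrbit.mk σ k = TupleOrbit.mk σ k' ↔ ∃ m < p, (shift σ)^[m] k = k' := by
  constructor
  · intro h
    have key : ∃ m : ℤ, ⇑(σ.perm ^ m) ∘ k.1 = k'.1 := by
      have h' := Quot.eqvGen_exact h
      clear h
      induction h' with
      | rel x y h => exact ⟨1, by rw [zpow_one, h]⟩
      | refl x => exact ⟨0, rfl⟩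
      | symm x y _ ih =>
        obtain ⟨m, hm⟩ := ih
        refine ⟨-m, ?_⟩
        rw [← hm, ← Function.comp_assoc, ← Equiv.Perm.coe_mul, ← zpow_add]
        simp
      | trans x y z _ _ ih₁ ih₂ =>
        obtain ⟨m, hm⟩ := ih₁
        obtain ⟨m', hm'⟩ := ih₂
        refine ⟨m' + m, ?_⟩
        rw [zpow_add, Equiv.Perm.coe_mul, Function.comp_assoc, hm, hm']
    obtain ⟨m, hm⟩ := key
    obtain ⟨j, hj, hmj⟩ := σ.exists_pow_eq_zpow m
    exact ⟨j, hj, Subtype.ext (by rw [coe_shift_iterate, ← hmj, hm])⟩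
  · rintro ⟨m, -, rfl⟩
    exact (mk_shift_iterate σ m k).symm

/-- For `n > 0` the cyclic group generated by `σ` acts freely on `n`-tuples. -/
theorem shift_iterate_injOn (hn : 0 < n) (k : orbitTuples σ n α) :
    Set.InjOn (fun m => (shift σ)^[m] k) (Finset.range p) := by
  have key : ∀ i j, i < j → j < p → (shift σ)^[i] k ≠ (shift σ)^[j] k := fun i j hij hj h => by
    obtain ⟨m, rfl⟩ := Nat.exists_eq_add_of_lt hij
    rw [add_assoc, Function.iterate_add_apply] at h
    have h' := congrFun (congrArg Subtype.val ((shift_bijective σ).injective.iterate i h)) ⟨0, hn⟩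
    rw [coe_shift_iterate] at h'
    exact σ.pow_ne (m + 1) (by omega) (by omega) _ h'.symm
  intro i hi j hj h
  simp only [Finset.coe_range, Set.mem_Iio] at hi hj
  rcases lt_trichotomy i j with hij | hij | hij
  · exact (key i j hij hj h).elim
  · exact hij
  · exact (key j i hij hi h.symm).elim

/-- The class map `K^β → K^{[α]}_σ`, for `β ∈ [α]`. -/
def classMap (β : orbit σ α) (k : tuples n β.1) : TupleOrbit σ n α :=
  TupleOrbit.mk σ ⟨k.1, Set.mem_biUnion β.2 k.2⟩

theorem isCovering_classMap (β : orbit σ α) :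
    IsCovering (tupleData Γ n β.1) (orbitData σ n α) (classMap σ β) where
  surjective γ := by
    obtain ⟨⟨k, hk⟩, rfl⟩ := Quot.exists_rep γ
    obtain ⟨β, i, rfl⟩ := β
    simp only [orbitTuples, Set.mem_iUnion] at hk
    obtain ⟨_, ⟨j, rfl⟩, hk⟩ := id hk
    obtain ⟨m, hm, h⟩ := σ.exists_pow_eq_zpow (i - j)
    refine ⟨⟨⇑(σ.perm ^ m) ∘ k, (comp_mem_iff _ _ _).1 ?_⟩,
      ((mk_eq_mk_iff σ).2 ⟨m, hm, Subtype.ext (coe_shift_iterate σ m _)⟩).symm⟩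
    convert hk using 2
    ext x
    simp [permComp_apply, ← h, zpow_sub]
  map_swap a ha k := rfl
  same_iff a b k := Iff.rfl
  edge_iff a b k := Iff.rfl

end Orbits

/-! ### The homomorphism to the fixed points -/

section FixedHom

variable {K : Type*} {Γ : Digraph K} {p : ℕ} (σ : FreeAut Γ p) (F : Type*) [CommRing F] {n : ℕ}
  (α : K →₀ ℕ)

/-- The homomorphism from the presented algebra to `R_{[α]}(Γ)`, with components the pullbacks
along the class maps. -/
noncomputable def toROrbit (n : ℕ) : FixedPresentation σ F n α →ₐ[F] ROrbit σ F n α :=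
  AlgHom.pi fun β => (isCovering_classMap σ β).pullback F (isPlaceAction_tupleData Γ n β.1)

theorem toROrbit_y (a : Fin n) : toROrbit σ F α n (y F _ a) = yOrbit σ F α a :=
  funext fun β => IsCovering.pullback_y F (isCovering_classMap σ β) _ a

theorem toROrbit_psi (a : Fin (n - 1)) : toROrbit σ F α n (psi F _ a) = psiOrbit σ F α a :=
  funext fun β => IsCovering.pullback_psi F (isCovering_classMap σ β) _ a

variable {α}

theorem eTuple_apply_of_mem {k : orbitTuples σ n α} {β : orbit σ α} (h : k.1 ∈ tuples n β.1) :
    eTuple σ F k β = e F _ ⟨k.1, h⟩ := dif_pos h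

theorem eTuple_apply_of_notMem {k : orbitTuples σ n α} {β : orbit σ α}
    (h : k.1 ∉ tuples n β.1) : eTuple σ F k β = 0 := dif_neg h

/-- The component in `R_β(Γ)` of a sum of idempotents `e(k)` only sees the `k ∈ K^β`. -/
theorem sum_eTuple_apply (P : orbitTuples σ n α → Prop) [DecidablePred P] (β : orbit σ α) :
    (∑ k with P k, eTuple σ F k) β =
      ∑ k : tuples n β.1 with P ⟨k.1, Set.mem_biUnion β.2 k.2⟩, e F (tupleData Γ n β.1) k := by
  rw [Finset.sum_apply]
  symm
  refine Finset.sum_of_injOn (fun k => ⟨k.1, Set.mem_biUnion β.2 k.2⟩) ?_ ?_ ?_ ?_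
  · intro k _ k' _ h
    exact Subtype.ext (Subtype.mk.inj h)
  · intro k hk
    simpa using hk
  · intro k hk hk'
    refine eTuple_apply_of_notMem σ F fun h => hk' ⟨⟨k.1, h⟩, ?_, rfl⟩
    simpa using hk
  · intro k _
    exact (eTuple_apply_of_mem σ F (k := ⟨k.1, _⟩) k.2).symm

theorem toROrbit_e (γ : TupleOrbit σ n α) : toROrbit σ F α n (e F _ γ) = eOrbit σ F γ := by
  classical
  funext β
  refine (IsCovering.pullback_e F (isCovering_classMap σ β) _ γ).trans ?_
  rw [eOrbit, sum_eTuple_apply]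
  rfl

theorem sum_eOrbit : ∑ γ, eOrbit σ F γ = (1 : ROrbit σ F n α) := by
  simp only [← toROrbit_e, ← map_sum, sum_e, map_one]

theorem eTuple_mul_self (k : orbitTuples σ n α) :
    eTuple σ F k * eTuple σ F k = eTuple σ F k := by
  funext β
  rw [Pi.mul_apply]
  by_cases h : k.1 ∈ tuples n β.1
  · rw [eTuple_apply_of_mem σ F h, e_mul_self]
  · rw [eTuple_apply_of_notMem σ F h, zero_mul]

theorem eTuple_mul_of_ne {k k' : orbitTuples σ n α} (hk : k ≠ k') :
    eTuple σ F k * eTuple σ F k' = 0 := by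
  funext β
  rw [Pi.mul_apply]
  by_cases h : k.1 ∈ tuples n β.1
  · by_cases h' : k'.1 ∈ tuples n β.1
    · rw [eTuple_apply_of_mem σ F h, eTuple_apply_of_mem σ F h', e_mul_of_ne]
      · rfl
      · exact fun he => hk (Subtype.ext (Subtype.mk.inj he))
    · rw [eTuple_apply_of_notMem σ F h', mul_zero]; rfl
  · rw [eTuple_apply_of_notMem σ F h, zero_mul]; rfl

theorem eTuple_mul_y (k : orbitTuples σ n α) (a : Fin n) :
    eTuple σ F k * yOrbit σ F α a = yOrbit σ F α a * eTuple σ F k := by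
  funext β
  rw [Pi.mul_apply, Pi.mul_apply]
  by_cases h : k.1 ∈ tuples n β.1
  · rw [eTuple_apply_of_mem σ F h, yOrbit, y_mul_e]
  · rw [eTuple_apply_of_notMem σ F h, zero_mul, mul_zero]

theorem eTuple_mul_psi (k : orbitTuples σ n α) (a : Fin (n - 1)) :
    eTuple σ F k * psiOrbit σ F α a = psiOrbit σ F α a *
      eTuple σ F ⟨swapTuple a.1 (by omega) k.1, swapTuple_mem_orbitTuples σ a.1 _ k.2⟩ := by
  funext β
  rw [Pi.mul_apply, Pi.mul_apply]
  by_cases h : k.1 ∈ tuples n β.1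
  · rw [eTuple_apply_of_mem σ F h, eTuple_apply_of_mem σ F (swapTuple_mem a.1 _ h), psiOrbit]
    have h' := psi_mul_e (F := F) (D := tupleData Γ n β.1) a.1 (by omega)
      ((tupleData Γ n β.1).swap a.1 (by omega) ⟨k.1, h⟩)
    rw [(isPlaceAction_tupleData Γ n β.1).swap_swap] at h'
    exact h'.symm
  · rw [eTuple_apply_of_notMem σ F h, eTuple_apply_of_notMem σ F, zero_mul, mul_zero]
    intro h'
    refine h ?_
    have h'' := swapTuple_mem a.1 (by omega) h'
    have e : swapTuple a.1 (by omega) (swapTuple a.1 (by omega) k.1) = k.1 := by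
      funext b
      simp [swapTuple]
    rwa [e] at h''

theorem sigma_eTuple (k : orbitTuples σ n α) :
    sigma σ F n α (eTuple σ F k) = eTuple σ F (shift σ k) := by
  funext β
  change sigmaHom σ F n β.1 (eTuple σ F k ⟨permComp σ.perm⁻¹ β.1, permComp_inv_mem σ β.2⟩) = _
  have hiff := comp_mem_iff σ.perm β.1 k.1
  by_cases h : k.1 ∈ tuples n (permComp σ.perm⁻¹ β.1)
  · rw [eTuple_apply_of_mem σ F h, eTuple_apply_of_mem σ F (k := shift σ k) (hiff.1 h)]
    exact Alg.map_e F _ _ _ _ _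
  · rw [eTuple_apply_of_notMem σ F h, eTuple_apply_of_notMem σ F (k := shift σ k) (mt hiff.2 h),
      map_zero]

theorem sigma_eOrbit (γ : TupleOrbit σ n α) :
    sigma σ F n α (eOrbit σ F γ) = eOrbit σ F γ := by
  classical
  rw [eOrbit, map_sum]
  refine Finset.sum_bijective (shift σ) (shift_bijective σ) (fun k => ?_)
    (fun k _ => sigma_eTuple σ F k)
  simp [mk_shift]

theorem sigma_toROrbit (b : FixedPresentation σ F n α) :
    sigma σ F n α (toROrbit σ F α n b) = toROrbit σ F α n b := by
  refine DFunLike.congr_fun (Alg.hom_ext (f := (sigma σ F n α).comp (toROrbit σ F α n))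
    (g := toROrbit σ F α n) ?_ ?_ ?_) b
  · intro γ
    rw [AlgHom.comp_apply, toROrbit_e, sigma_eOrbit]
  · intro a
    rw [AlgHom.comp_apply, toROrbit_y]
    exact funext fun β => Alg.map_y F _ _ _ _ a
  · intro a
    rw [AlgHom.comp_apply, toROrbit_psi]
    exact funext fun β => Alg.map_psi F _ _ _ _ a

variable (α) in
/-- Every class has a representative in `K^α`, so the component in `R_α(Γ)` is already injective. -/
theorem toROrbit_injective : Function.Injective (toROrbit σ F α n) := fun _ _ h =>
  (isCovering_classMap σ ⟨α, 0, by ext; simp [permComp_apply]⟩).pullback_injective F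
    (isPlaceAction_tupleData Γ n _) (congrFun h _)

/-! ### Traces and surjectivity -/

variable (α) in
/-- The trace `∑ σ^m`, `0 ≤ m < p`, of the cyclic group generated by `σ`. -/
noncomputable def trace (n : ℕ) : ROrbit σ F n α →ₗ[F] ROrbit σ F n α :=
  ∑ m ∈ Finset.range p, (sigma σ F n α ^ m).toLinearMap

theorem trace_apply (a : ROrbit σ F n α) :
    trace σ F α n a = ∑ m ∈ Finset.range p, (sigma σ F n α ^ m) a := by
  simp [trace]

theorem sigma_pow_eq_self {r : ROrbit σ F n α} (hr : sigma σ F n α r = r) (m : ℕ) :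
    (sigma σ F n α ^ m) r = r := by
  induction m with
  | zero => rfl
  | succ m ih => rw [pow_succ, AlgHom.mul_apply, hr, ih]

theorem trace_mul_of_fixed {r : ROrbit σ F n α} (hr : sigma σ F n α r = r)
    (a : ROrbit σ F n α) : trace σ F α n (a * r) = trace σ F α n a * r := by
  simp only [trace_apply, map_mul, sigma_pow_eq_self σ F hr, Finset.sum_mul]

theorem trace_fixed_mul {r : ROrbit σ F n α} (hr : sigma σ F n α r = r)
    (a : ROrbit σ F n α) : trace σ F α n (r * a) = r * trace σ F α n a := by
  simp only [trace_apply, map_mul, sigma_pow_eq_self σ F hr, Finset.mul_sum]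

theorem sigma_pow_eTuple (m : ℕ) (k : orbitTuples σ n α) :
    (sigma σ F n α ^ m) (eTuple σ F k) = eTuple σ F ((shift σ)^[m] k) := by
  induction m with
  | zero => rfl
  | succ m ih =>
    rw [pow_succ', AlgHom.mul_apply, ih, sigma_eTuple, Function.iterate_succ_apply']

/-- As the action on tuples is free, the trace of `e(k)` is the sum over the orbit of `k`. -/
theorem trace_eTuple (hn : 0 < n) (k : orbitTuples σ n α) :
    trace σ F α n (eTuple σ F k) = eOrbit σ F (TupleOrbit.mk σ k) := by
  classical
  simp only [trace_apply, sigma_pow_eTuple, eOrbit]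
  rw [← Finset.sum_image (f := fun k => eTuple σ F k) (shift_iterate_injOn σ hn k)]
  refine Finset.sum_congr ?_ fun _ _ => rfl
  ext k'
  simp only [Finset.mem_image, Finset.mem_range, Finset.mem_filter, Finset.mem_univ, true_and]
  rw [eq_comm, mk_eq_mk_iff]

theorem mul_single [DecidableEq (orbit σ α)] (r : ROrbit σ F n α) (β : orbit σ α)
    (c : R F Γ n β.1) :
    r * Pi.single β c = (Pi.single β (r β * c) : ROrbit σ F n α) := by
  funext β'
  rcases eq_or_ne β' β with rfl | h
  · simp
  · simp [h]

/-- The sets `K^β` are pairwise disjoint, so that `e(k)` has only one nonzero component. -/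
theorem eTuple_eq_single [DecidableEq (orbit σ α)] (k : orbitTuples σ n α) (β : orbit σ α)
    (h : k.1 ∈ tuples n β.1) : eTuple σ F k = Pi.single β (e F _ ⟨k.1, h⟩) := by
  funext β'
  rcases eq_or_ne β' β with rfl | hβ
  · rw [eTuple_apply_of_mem σ F h, Pi.single_eq_same]
  · rw [Pi.single_eq_of_ne hβ, eTuple_apply_of_notMem]
    exact fun h' => hβ (Subtype.ext (Finsupp.ext fun x => by rw [← h' x, ← h x]))

/-- The elements `a` such that the traces of all `e(k) a` are in the range of `toROrbit` form a left
ideal: moving `y_a` or `ψ_a` to the left of an `e(k)` gives a factor fixed by `σ`, over which the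
trace is linear. -/
theorem trace_eTuple_mul_single_mul_mem [DecidableEq (orbit σ α)] (β : orbit σ α)
    (b c : R F Γ n β.1)
    (hc : ∀ k, trace σ F α n (eTuple σ F k * Pi.single β c) ∈ (toROrbit σ F α n).range)
    (k : orbitTuples σ n α) :
    trace σ F α n (eTuple σ F k * Pi.single β (b * c)) ∈ (toROrbit σ F α n).range := by
  induction b using Alg.induction generalizing c k with
  | algebraMap r =>
    rw [← Algebra.smul_def, Pi.single_smul, mul_smul_comm, map_smul]
    exact Subalgebra.smul_mem _ (hc k) r
  | he k' =>
    have h := mul_single σ F (eTuple σ F ⟨k'.1, Set.mem_biUnion β.2 k'.2⟩) β c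
    rw [eTuple_apply_of_mem σ F k'.2] at h
    rw [← h, ← mul_assoc]
    by_cases hk : k = ⟨k'.1, Set.mem_biUnion β.2 k'.2⟩
    · rw [← hk, eTuple_mul_self]
      exact hc k
    · rw [eTuple_mul_of_ne σ F hk, zero_mul, map_zero]
      exact zero_mem _
  | hy a =>
    have h : yOrbit σ F α a * Pi.single β c =
        (Pi.single β (y F _ a * c) : ROrbit σ F n α) := mul_single σ F _ β c
    rw [← h, ← mul_assoc, eTuple_mul_y, mul_assoc, ← toROrbit_y,
      trace_fixed_mul σ F (sigma_toROrbit σ F _)]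
    exact mul_mem ⟨_, rfl⟩ (hc k)
  | hpsi a =>
    have h : psiOrbit σ F α a * Pi.single β c =
        (Pi.single β (psi F _ a * c) : ROrbit σ F n α) := mul_single σ F _ β c
    rw [← h, ← mul_assoc, eTuple_mul_psi, mul_assoc, ← toROrbit_psi,
      trace_fixed_mul σ F (sigma_toROrbit σ F _)]
    exact mul_mem ⟨_, rfl⟩ (hc _)
  | mul a b ha hb =>
    rw [mul_assoc]
    exact ha _ (hb c hc) k
  | add a b ha hb =>
    rw [add_mul, Pi.single_add, mul_add, map_add]
    exact add_mem (ha c hc k) (hb c hc k)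

theorem trace_eTuple_mul_single_mem [DecidableEq (orbit σ α)] (hn : 0 < n) (β : orbit σ α)
    (a : R F Γ n β.1) (k : orbitTuples σ n α) :
    trace σ F α n (eTuple σ F k * Pi.single β a) ∈ (toROrbit σ F α n).range := by
  rw [← mul_one a]
  refine trace_eTuple_mul_single_mul_mem σ F β a 1 (fun k => ?_) k
  rw [mul_single, mul_one]
  by_cases h : k.1 ∈ tuples n β.1
  · rw [eTuple_apply_of_mem σ F h, ← eTuple_eq_single, trace_eTuple σ F hn, ← toROrbit_e]
    exact ⟨_, rfl⟩
  · rw [eTuple_apply_of_notMem σ F h, Pi.single_zero, map_zero]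
    exact zero_mem _

theorem trace_eTuple_mul_mem (hn : 0 < n) (a : ROrbit σ F n α) (k : orbitTuples σ n α) :
    trace σ F α n (eTuple σ F k * a) ∈ (toROrbit σ F α n).range := by
  classical
  have : Fintype (orbit σ α) := (finite_orbit σ α).fintype
  rw [← Finset.univ_sum_single a, Finset.mul_sum, map_sum]
  exact sum_mem fun β _ => trace_eTuple_mul_single_mem σ F hn β _ k

/-- A fixed point `r` is the sum of the elements `e(γ) r`, and `e(γ) r` is the trace of `e(k) r` for
any `k ∈ γ`. -/
theorem mem_range_toROrbit (hn : 0 < n) {r : ROrbit σ F n α} (hr : sigma σ F n α r = r) :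
    r ∈ (toROrbit σ F α n).range := by
  rw [← one_mul r, ← sum_eOrbit, Finset.sum_mul]
  refine sum_mem fun γ _ => ?_
  obtain ⟨k, rfl⟩ := Quot.exists_rep γ
  have h := trace_eTuple_mul_mem σ F hn r k
  rwa [trace_mul_of_fixed σ F hr, trace_eTuple σ F hn] at h

end FixedHom

end QHA

theorem mainTheorem6 {F : Type*} [Field F] {K : Type*} (Γ : Digraph K)
    (hΓ : ∀ k, ¬ Γ.Adj k k) {p : ℕ} (σ : QHA.FreeAut Γ p) {n : ℕ} (hn : 0 < n)
    (α : K →₀ ℕ) (hα : (α.sum fun _ m => m) = n) :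
    ∃ f : QHA.FixedPresentation σ F n α ≃ₐ[F] QHA.fixedSubalgebra σ F n α,
      (∀ γ : QHA.TupleOrbit σ n α,
        (f (QHA.e F (QHA.orbitData σ n α) γ) : QHA.ROrbit σ F n α) = QHA.eOrbit σ F γ) ∧
      (∀ a : Fin n,
        (f (QHA.y F (QHA.orbitData σ n α) a) : QHA.ROrbit σ F n α) = QHA.yOrbit σ F α a) ∧
      (∀ a : Fin (n - 1),
        (f (QHA.psi F (QHA.orbitData σ n α) a) : QHA.ROrbit σ F n α) = QHA.psiOrbit σ F α a) := by
  refine ⟨AlgEquiv.ofBijective ((QHA.toROrbit σ F α n).codRestrict _ (QHA.sigma_toROrbit σ F))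
    ⟨fun b b' h => QHA.toROrbit_injective σ F α (congrArg Subtype.val h), fun r => ?_⟩,
    QHA.toROrbit_e σ F, QHA.toROrbit_y σ F α, QHA.toROrbit_psi σ F α⟩
  obtain ⟨b, hb⟩ := QHA.mem_range_toROrbit σ F hn r.2
  exact ⟨b, Subtype.ext hb⟩
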